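/- Graphs are finite and simple. The spectral radius of a graph is the largest eigenvalue of its adjacency matrix. A dissociation set of a graph is a set of vertices that induces a subgraph of maximum degree at most $1$, and the dissociation number of a graph is the maximum cardinality of a dissociation set. In a tree $T$, a branch vertex is a vertex of degree larger than $2$. A branch path attached to a branch vertex $v$ is a path $P$ in $T$ hanging at $v$: one end of $P$ is adjacent to $v$, the other end of $P$ is a leaf of $T$ (the two ends coincide if $P$ is a single vertex), and all vertices of $P$ other than this leaf have degree $2$ in $T$. The vertex $v$ does not belong to $P$, and the length of $P$ is its number of edges; so a leaf adjacent to $v$ is a branch path of length $0$, and a pendant edge attached to $v$ through one of its ends is a branch path of length $1$. For integers $n,s,t\ge 0$ with $s+2t<n$, let $B(n,s,t)$ be the graph of order $n$ obtained from a path of order $n-s-2t$ by attaching $s$ leaves and $t$ disjoint edges (each joined through one of its two vertices) to the same end of the path. Let $n,k$ be integers with $\lceil 2n/3\rceil<k\le n-1$, and suppose that a tree $T$ attains the minimum spectral radius among all connected graphs of order $n$ with dissociation number $k$. Then either every branch path in $T$ has length at most one, or $T\cong B(n,s,t)$ for some integers $s\ge 0$ and $t\ge 1$ with $s+2t<n$.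 -/

import Mathlib

open Classical in
/-- The spectral radius of a finite graph: the largest (real) eigenvalue of its adjacency
matrix. -/
noncomputable def graphSpectralRadius {V : Type*} [Fintype V] (G : SimpleGraph V) : ℝ :=
  sSup {μ : ℝ | Module.End.HasEigenvalue (Matrix.toLin' (G.adjMatrix ℝ)) μ}

/-- A dissociation set: the subgraph it induces has maximum degree at most one. -/
def IsDissociationSet {V : Type*} (G : SimpleGraph V) (S : Finset V) : Prop :=
  ∀ v : (S : Set V), ((G.induce (S : Set V)).neighborSet v).encard ≤ 1

/-- The dissociation number: the maximum cardinality of a dissociation set. -/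
noncomputable def dissociationNumber {V : Type*} (G : SimpleGraph V) : ℕ :=
  sSup {m : ℕ | ∃ S : Finset V, IsDissociationSet G S ∧ S.card = m}

/-- The connected graphs of order `n` (labelled by `Fin n`) with dissociation number `k`. -/
def connectedDissGraphs (n k : ℕ) : Set (SimpleGraph (Fin n)) :=
  {G | G.Connected ∧ dissociationNumber G = k}

/-- `G` has the minimum spectral radius among the connected graphs of order `n` with
dissociation number `k`. -/
def AttainsMinSpectralRadius (n k : ℕ) (G : SimpleGraph (Fin n)) : Prop :=
  G ∈ connectedDissGraphs n k ∧
    ∀ H ∈ connectedDissGraphs n k, graphSpectralRadius G ≤ graphSpectralRadius H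

/-- The walk `p`, from `a` to `b`, is a branch path attached to the branch vertex `v`
(a vertex of degree larger than two): it is a path hanging at `v`, that is, `a` is adjacent to
`v`, the vertices of `p` other than `b` have degree two in the graph, and `b` is a leaf.
The vertex `v` does not belong to `p`, so `p.length` is the length of the branch path:
it is `0` for a leaf attached to `v` and `1` for a branch edge attached to `v`. -/
structure IsBranchPath {V : Type*} (T : SimpleGraph V) (v : V) {a b : V} (p : T.Walk a b) :
    Prop where
  isPath : p.IsPath
  branch : 2 < (T.neighborSet v).encard
  attached : T.Adj v a
  degree_eq_two : ∀ u ∈ p.support, u ≠ b → (T.neighborSet u).encard = 2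
  leaf : (T.neighborSet b).encard = 1

/-- The graph obtained from the path on the vertices `inl 0, inl 1, …, inl (p - 1)` by attaching
at its end `inl 0` the `s` leaves `inr (inl i)` and the `t` edges
`inr (inr (j, 0)) — inr (inr (j, 1))` (each through its vertex `inr (inr (j, 0))`). -/
def broomOnPath (p s t : ℕ) : SimpleGraph (Fin p ⊕ Fin s ⊕ Fin t × Fin 2) :=
  SimpleGraph.fromRel fun x y =>
    match x, y with
    | .inl i, .inl j => i.val + 1 = j.val
    | .inl i, .inr (.inl _) => i.val = 0
    | .inl i, .inr (.inr (_, c)) => i.val = 0 ∧ c = 0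
    | .inr (.inr (j, c)), .inr (.inr (j', c')) => j = j' ∧ c = 0 ∧ c' = 1
    | _, _ => False

/-- The graph `B(n, s, t)` of order `n` (meaningful for `s + 2 * t < n`), obtained from a path
of order `n - s - 2 * t` by attaching `s` leaves and `t` edges to the same end of that path. -/
def broomTree (n s t : ℕ) : SimpleGraph (Fin (n - s - 2 * t) ⊕ Fin s ⊕ Fin t × Fin 2) :=
  broomOnPath (n - s - 2 * t) s t

/-!
Let `ρ` be the spectral radius of `T` and `x > 0` an eigenvector for it (`exists_pos_eigenvector`).
To see that a connected graph `H` on the same vertices has a smaller spectral radius, it suffices to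
exhibit a positive vector that the adjacency operator of `H` multiplies by at most `ρ`, strictly
somewhere (`graphSpectralRadius_lt`). Three kinds of modification keep the dissociation number and
admit such a vector, so none of them is possible in a minimizing tree.

Replacing an edge by a path with three new vertices, or hanging a path with three vertices at a
vertex, increases the dissociation number by exactly two (`dissociationNumber_insertPath`,
`dissociationNumber_attachPath`; the new vertices are isolated beforehand, where they contribute
three, hence the form of these statements). So three vertices may be moved from the end of a long
branch path into an edge.

* Suppose that `T` has a branch path of length at least two and two branch vertices. Let `u` be a
  vertex at which `x` is smallest on the path joining these, and `w` a neighbour of `u` on that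
  path. Inserting three vertices into `uw` does not increase the spectral radius: on the side of
  `w` the vector is scaled, and the values on the new vertices are forced
  (`graphSpectralRadius_insertPath_lt`). Here `ρ ≥ 2` is needed, and it holds because of the two
  branch vertices. Removing the end of the long branch path makes the inequality strict
  (`hasImprovement_of_isBranchCore`).
* Suppose that two branch paths at `v` have length at least two. Three vertices are moved from the
  one on which `x` is smaller next to `v` to the other. The inequality at `v` comes down to the fact
  that the ratio of consecutive values along a leg obeys the contraction `t ↦ 1 / (ρ - t)`
  (`add_iterate_lt`, `hasImprovement_of_two_legs`).
* Suppose that two leaves are attached to a branch vertex. One of them may be moved to the other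
  (`hasImprovement_of_two_leaves`).

Hence, if `T` has a branch path of length at least two, then its only branch vertex carries exactly
one such path, at most one leaf, and otherwise branch paths of length one, of which there is at
least one because the degree is at least three. Such a tree is the graph `broomTree`
(`exists_iso_broomOnPath`).
-/

/-! ### The spectral radius and positive vectors -/

open Classical in
/-- The value at `q` of the adjacency operator of `G` applied to `y`: the sum of `y` over the
neighbours of `q`. -/
noncomputable def adjSum {V : Type*} [Fintype V] (G : SimpleGraph V) (y : V → ℝ) (q : V) : ℝ :=
  ∑ r, if G.Adj q r then y r else 0

section Perron

variable {V : Type*} [Fintype V] {G : SimpleGraph V}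

open Classical in
theorem adjMatrix_mulVec_eq_adjSum (y : V → ℝ) (q : V) :
    (G.adjMatrix ℝ).mulVec y q = adjSum G y q := by
  simp [Matrix.mulVec, dotProduct, adjSum, SimpleGraph.adjMatrix_apply]

theorem sum_mul_adjSum_comm (x y : V → ℝ) :
    ∑ q, x q * adjSum G y q = ∑ q, y q * adjSum G x q := by
  classical
  simp only [adjSum, Finset.mul_sum]
  rw [Finset.sum_comm]
  refine Finset.sum_congr rfl fun q _ => Finset.sum_congr rfl fun r _ => ?_
  by_cases h : G.Adj r q
  · simp [h, h.symm, mul_comm]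
  · have h' : ¬ G.Adj q r := fun h' => h h'.symm
    simp [h, h']

theorem adjSum_add (x y : V → ℝ) (q : V) :
    adjSum G (x + y) q = adjSum G x q + adjSum G y q := by
  classical
  simp only [adjSum, ← Finset.sum_add_distrib]
  refine Finset.sum_congr rfl fun r _ => ?_
  split_ifs <;> simp

theorem adjSum_smul (c : ℝ) (x : V → ℝ) (q : V) :
    adjSum G (c • x) q = c * adjSum G x q := by
  classical
  simp only [adjSum, Finset.mul_sum]
  refine Finset.sum_congr rfl fun r _ => ?_
  split_ifs <;> simp

theorem adjSum_nonneg {y : V → ℝ} (hy : ∀ q, 0 ≤ y q) (q : V) : 0 ≤ adjSum G y q := by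
  classical
  refine Finset.sum_nonneg fun r _ => ?_
  split_ifs
  · exact hy r
  · exact le_rfl

/-- A nonnegative vector maximizing the quadratic form of the adjacency matrix on the unit
sphere; taking absolute values does not decrease the form. -/
theorem exists_nonneg_quadratic_max [Nonempty V] (G : SimpleGraph V) :
    ∃ x : V → ℝ, (∀ q, 0 ≤ x q) ∧ ∑ q, x q * x q = 1 ∧
      ∀ y : V → ℝ, ∑ q, y q * adjSum G y q
        ≤ (∑ q, x q * adjSum G x q) * ∑ q, y q * y q := by
  classical
  set F : (V → ℝ) → ℝ := fun y => ∑ q, y q * adjSum G y q with hF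
  set S : Set (V → ℝ) := {y | ∑ q, y q * y q = 1} with hS
  have hcont : Continuous F := by
    simp only [hF, adjSum]
    refine continuous_finsetSum _ fun q _ => (continuous_apply q).mul ?_
    refine continuous_finsetSum _ fun r _ => ?_
    split_ifs
    · exact continuous_apply r
    · exact continuous_const
  have hclosed : IsClosed S := isClosed_eq (by fun_prop) continuous_const
  have hcomp : IsCompact S := by
    refine (isCompact_Icc (a := fun _ : V => (-1 : ℝ)) (b := fun _ => 1)).of_isClosed_subset
      hclosed fun y hy => ?_
    have hle : ∀ q, y q * y q ≤ 1 := fun q => by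
      rw [← (show ∑ q, y q * y q = 1 from hy)]
      exact Finset.single_le_sum (f := fun q => y q * y q)
        (fun i _ => mul_self_nonneg (y i)) (Finset.mem_univ q)
    exact ⟨fun q => by have := hle q; simp only; nlinarith,
      fun q => by have := hle q; simp only; nlinarith⟩
  have hne : S.Nonempty := by
    obtain ⟨v⟩ := ‹Nonempty V›
    exact ⟨fun q => if q = v then 1 else 0, by simp [hS]⟩
  obtain ⟨x, hxS, hmax⟩ := hcomp.exists_isMaxOn hne hcont.continuousOn
  have habs : F x ≤ F (fun q => |x q|) := by
    simp only [hF, adjSum, Finset.mul_sum]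
    refine Finset.sum_le_sum fun q _ => Finset.sum_le_sum fun r _ => ?_
    split_ifs
    · rw [← abs_mul]; exact le_abs_self _
    · simp
  have habsS : ∑ q, |x q| * |x q| = 1 := by
    simp only [abs_mul_abs_self]; exact hxS
  refine ⟨fun q => |x q|, fun q => abs_nonneg _, habsS, fun y => ?_⟩
  by_cases hy : ∑ q, y q * y q = 0
  · have h0 : y = 0 := by
      funext q
      have := (Finset.sum_eq_zero_iff_of_nonneg (fun i _ => mul_self_nonneg (y i))).1 hy q
        (Finset.mem_univ q)
      simpa using this
    simp [h0]
  · have hpos : 0 < ∑ q, y q * y q :=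
      lt_of_le_of_ne (Finset.sum_nonneg fun i _ => mul_self_nonneg (y i)) (Ne.symm hy)
    set N := ∑ q, y q * y q
    have hs : (√N)⁻¹ * (√N)⁻¹ = N⁻¹ := by
      rw [← mul_inv, Real.mul_self_sqrt hpos.le]
    have hyS : ((√N)⁻¹ • y) ∈ S := by
      have : ∑ q, ((√N)⁻¹ * y q) * ((√N)⁻¹ * y q) = N⁻¹ * N := by
        rw [← hs, Finset.mul_sum]
        exact Finset.sum_congr rfl fun q _ => by ring
      simpa [hS, hy] using this.trans (inv_mul_cancel₀ hy)
    have h1 : F ((√N)⁻¹ • y) ≤ F (fun q => |x q|) := (hmax hyS).trans habs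
    have h2 : F ((√N)⁻¹ • y) = N⁻¹ * F y := by
      simp only [hF, adjSum_smul, ← hs, Finset.mul_sum]
      exact Finset.sum_congr rfl fun q _ => by simp only [Pi.smul_apply, smul_eq_mul]; ring
    rw [h2, inv_mul_le_iff₀ hpos] at h1
    rw [mul_comm]
    exact h1

theorem graphSpectralRadius_eq_of_eigenvector {x : V → ℝ} {μ : ℝ} (hx : x ≠ 0)
    (hmu : ∀ q, adjSum G x q = μ * x q)
    (hform : ∀ y : V → ℝ, ∑ q, y q * adjSum G y q ≤ μ * ∑ q, y q * y q) :
    graphSpectralRadius G = μ := by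
  classical
  have key : IsGreatest {ν : ℝ | Module.End.HasEigenvalue
      (Matrix.toLin' (G.adjMatrix ℝ)) ν} μ := by
    constructor
    · refine Module.End.hasEigenvalue_of_hasEigenvector (x := x) ⟨?_, hx⟩
      rw [Module.End.mem_eigenspace_iff, Matrix.toLin'_apply]
      funext q
      rw [adjMatrix_mulVec_eq_adjSum, hmu]
      rfl
    · intro ν hν
      obtain ⟨y, hy, hy0⟩ := Module.End.HasEigenvalue.exists_hasEigenvector hν
      rw [Module.End.mem_eigenspace_iff, Matrix.toLin'_apply] at hy
      have hy' : ∀ q, adjSum G y q = ν * y q := fun q => by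
        rw [← adjMatrix_mulVec_eq_adjSum, hy]; rfl
      have hpos : 0 < ∑ q, y q * y q := by
        obtain ⟨q, hq⟩ := Function.ne_iff.1 hy0
        exact Finset.sum_pos' (fun i _ => mul_self_nonneg (y i))
          ⟨q, Finset.mem_univ q, mul_self_pos.2 hq⟩
      have := hform y
      simp only [hy'] at this
      have h2 : ∑ q, y q * (ν * y q) = ν * ∑ q, y q * y q := by
        rw [Finset.mul_sum]; exact Finset.sum_congr rfl fun q _ => by ring
      rw [h2] at this
      exact le_of_mul_le_mul_right this hpos
  have : graphSpectralRadius G = sSup {ν : ℝ | Module.End.HasEigenvalue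
      (Matrix.toLin' (G.adjMatrix ℝ)) ν} := by
    unfold graphSpectralRadius
    congr!
  rw [this, key.csSup_eq]

/-- A connected graph has a positive eigenvector for its spectral radius. -/
theorem exists_pos_eigenvector (hG : G.Connected) :
    ∃ x : V → ℝ, (∀ q, 0 < x q) ∧ ∀ q, adjSum G x q = graphSpectralRadius G * x q := by
  classical
  have := hG.nonempty
  obtain ⟨x, hx0, hx1, hmax⟩ := exists_nonneg_quadratic_max G
  set μ := ∑ q, x q * adjSum G x q with hmu_def
  -- First-order optimality: perturbing `x` by `t` in the coordinate `q`.
  have heig : ∀ q, adjSum G x q = μ * x q := by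
    intro q
    set e : V → ℝ := fun r => if r = q then 1 else 0 with he
    have hpert : ∀ t : ℝ, 0 ≤ (μ - ∑ r, e r * adjSum G e r) * (t * t)
        + 2 * (μ * x q - adjSum G x q) * t + 0 := by
      intro t
      have h := hmax (x + t • e)
      have h1 : ∑ r, (x + t • e) r * adjSum G (x + t • e) r
          = μ + 2 * t * adjSum G x q + t * t * ∑ r, e r * adjSum G e r := by
        have hexp : ∀ r, (x + t • e) r * adjSum G (x + t • e) r
            = x r * adjSum G x r + t * (x r * adjSum G e r) + t * (e r * adjSum G x r)
              + t * t * (e r * adjSum G e r) := fun r => by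
          rw [adjSum_add, adjSum_smul]
          simp only [Pi.add_apply, Pi.smul_apply, smul_eq_mul]; ring
        simp only [hexp, Finset.sum_add_distrib, ← Finset.mul_sum]
        rw [sum_mul_adjSum_comm x e]
        have : ∑ r, e r * adjSum G x r = adjSum G x q := by simp [he]
        rw [this]; ring
      have h2 : ∑ r, (x + t • e) r * (x + t • e) r = 1 + 2 * t * x q + t * t := by
        have hexp : ∀ r, (x + t • e) r * (x + t • e) r
            = x r * x r + 2 * t * (e r * x r) + t * t * e r := fun r => by
          simp only [he, Pi.add_apply, Pi.smul_apply, smul_eq_mul]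
          split_ifs <;> ring
        simp only [hexp, Finset.sum_add_distrib, ← Finset.mul_sum]
        rw [hx1]; simp [he]
      rw [h1, h2] at h
      linarith
    have hd := discrim_le_zero hpert
    simp only [discrim] at hd
    nlinarith [sq_nonneg (μ * x q - adjSum G x q)]
  have hxne : x ≠ 0 := by rintro rfl; simp at hx1
  have hrho : graphSpectralRadius G = μ := graphSpectralRadius_eq_of_eigenvector hxne heig hmax
  refine ⟨x, fun q => ?_, by rw [hrho]; exact heig⟩
  -- The zero set of `x` is closed under adjacency.
  have hstep : ∀ {u v}, G.Adj u v → x u = 0 → x v = 0 := by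
    intro u v huv hu
    have h0 : adjSum G x u = 0 := by rw [heig, hu, mul_zero]
    have := (Finset.sum_eq_zero_iff_of_nonneg (fun r _ => by
      split_ifs
      exacts [hx0 r, le_rfl])).1 h0 v (Finset.mem_univ v)
    simpa [huv] using this
  by_contra hq
  have hq0 : x q = 0 := le_antisymm (not_lt.1 hq) (hx0 q)
  refine hxne (funext fun r => ?_)
  obtain ⟨w⟩ := hG.preconnected q r
  induction w with
  | nil => exact hq0
  | cons h _ ih => exact ih (by rw [hstep h hq0]; exact lt_irrefl 0) (hstep h hq0)

/-- A positive vector that the adjacency operator multiplies by at most `μ`, strictly somewhere,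
certifies that the spectral radius is smaller than `μ`. -/
theorem graphSpectralRadius_lt (hG : G.Connected) {y : V → ℝ} {μ : ℝ}
    (hle : ∀ q, adjSum G y q ≤ μ * y q) (hy : ∀ q, 0 < y q)
    (hlt : ∃ q, adjSum G y q < μ * y q) :
    graphSpectralRadius G < μ := by
  obtain ⟨x, hx, heig⟩ := exists_pos_eigenvector hG
  obtain ⟨q₀, hq₀⟩ := hlt
  have hpos : 0 < ∑ q, x q * y q :=
    Finset.sum_pos' (fun q _ => (mul_pos (hx q) (hy q)).le)
      ⟨q₀, Finset.mem_univ _, mul_pos (hx q₀) (hy q₀)⟩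
  have h1 : ∑ q, x q * adjSum G y q < ∑ q, x q * (μ * y q) :=
    Finset.sum_lt_sum (fun q _ => mul_le_mul_of_nonneg_left (hle q) (hx q).le)
      ⟨q₀, Finset.mem_univ _, mul_lt_mul_of_pos_left hq₀ (hx q₀)⟩
  rw [sum_mul_adjSum_comm] at h1
  simp only [heig] at h1
  have h2 : ∑ q, y q * (graphSpectralRadius G * x q)
      = graphSpectralRadius G * ∑ q, x q * y q := by
    rw [Finset.mul_sum]; exact Finset.sum_congr rfl fun q _ => by ring
  have h3 : ∑ q, x q * (μ * y q) = μ * ∑ q, x q * y q := by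
    rw [Finset.mul_sum]; exact Finset.sum_congr rfl fun q _ => by ring
  rw [h2, h3] at h1
  exact lt_of_mul_lt_mul_right h1 hpos.le

/-- A nonzero nonnegative vector that the adjacency operator multiplies by at least `μ`
certifies that an eigenvalue with a positive eigenvector is at least `μ`. -/
theorem le_of_pos_eigenvector {x y : V → ℝ} {ρ μ : ℝ} (hx : ∀ q, 0 < x q)
    (heig : ∀ q, adjSum G x q = ρ * x q) (hy : ∀ q, 0 ≤ y q) (hy' : ∃ q, 0 < y q)
    (hle : ∀ q, μ * y q ≤ adjSum G y q) : μ ≤ ρ := by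
  obtain ⟨q₀, hq₀⟩ := hy'
  have hpos : 0 < ∑ q, x q * y q :=
    Finset.sum_pos' (fun q _ => mul_nonneg (hx q).le (hy q))
      ⟨q₀, Finset.mem_univ _, mul_pos (hx q₀) hq₀⟩
  have h1 : ∑ q, x q * (μ * y q) ≤ ∑ q, x q * adjSum G y q :=
    Finset.sum_le_sum fun q _ => mul_le_mul_of_nonneg_left (hle q) (hx q).le
  rw [sum_mul_adjSum_comm] at h1
  simp only [heig] at h1
  have h2 : ∑ q, y q * (ρ * x q) = ρ * ∑ q, x q * y q := by
    rw [Finset.mul_sum]; exact Finset.sum_congr rfl fun q _ => by ring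
  have h3 : ∑ q, x q * (μ * y q) = μ * ∑ q, x q * y q := by
    rw [Finset.mul_sum]; exact Finset.sum_congr rfl fun q _ => by ring
  rw [h2, h3] at h1
  exact le_of_mul_le_mul_right h1 hpos

end Perron

/-! ### Inserting and attaching three vertices -/

open SimpleGraph in
/-- The graph obtained from `G` by hanging the path `c₁ c₂ c₃` at `z` through `c₁`; the vertices
`c₁`, `c₂`, `c₃` are meant to be isolated in `G`. -/
def attachPath {V : Type*} (G : SimpleGraph V) (z c₁ c₂ c₃ : V) : SimpleGraph V :=
  G ⊔ edge z c₁ ⊔ edge c₁ c₂ ⊔ edge c₂ c₃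

open SimpleGraph in
/-- The graph obtained from `G` by replacing the edge `uw` by the path `u c₁ c₂ c₃ w`; the
vertices `c₁`, `c₂`, `c₃` are meant to be isolated in `G`. -/
def insertPath {V : Type*} (G : SimpleGraph V) (u w c₁ c₂ c₃ : V) : SimpleGraph V :=
  G.deleteEdges {s(u, w)} ⊔ edge u c₁ ⊔ edge c₁ c₂ ⊔ edge c₂ c₃ ⊔ edge c₃ w

/-- Three distinct isolated vertices, available for subdividing an edge or for forming a pendant
path without changing the vertex set. -/
structure IsolatedTriple {V : Type*} (G : SimpleGraph V) (c₁ c₂ c₃ : V) : Prop where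
  ne₁₂ : c₁ ≠ c₂
  ne₁₃ : c₁ ≠ c₃
  ne₂₃ : c₂ ≠ c₃
  isolated₁ : ∀ r, ¬ G.Adj c₁ r
  isolated₂ : ∀ r, ¬ G.Adj c₂ r
  isolated₃ : ∀ r, ¬ G.Adj c₃ r

theorem attachPath_adj {V : Type*} {G : SimpleGraph V} {z c₁ c₂ c₃ : V}
    (hc : IsolatedTriple G c₁ c₂ c₃) (hz : z ≠ c₁) (q r : V) :
    (attachPath G z c₁ c₂ c₃).Adj q r ↔ G.Adj q r ∨ (q = z ∧ r = c₁) ∨ (q = c₁ ∧ r = z) ∨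
      (q = c₁ ∧ r = c₂) ∨ (q = c₂ ∧ r = c₁) ∨ (q = c₂ ∧ r = c₃) ∨ (q = c₃ ∧ r = c₂) := by
  have := hc.ne₁₂
  have := hc.ne₂₃
  simp only [attachPath, SimpleGraph.sup_adj, SimpleGraph.edge_adj]
  grind

theorem insertPath_adj {V : Type*} {G : SimpleGraph V} {u w c₁ c₂ c₃ : V}
    (hc : IsolatedTriple G c₁ c₂ c₃) (huw : G.Adj u w) (q r : V) :
    (insertPath G u w c₁ c₂ c₃).Adj q r ↔
      (G.Adj q r ∧ ¬ (q = u ∧ r = w) ∧ ¬ (q = w ∧ r = u)) ∨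
      (q = u ∧ r = c₁) ∨ (q = c₁ ∧ r = u) ∨ (q = c₁ ∧ r = c₂) ∨ (q = c₂ ∧ r = c₁) ∨
      (q = c₂ ∧ r = c₃) ∨ (q = c₃ ∧ r = c₂) ∨ (q = c₃ ∧ r = w) ∨ (q = w ∧ r = c₃) := by
  have := hc.ne₁₂
  have := hc.ne₂₃
  have : u ≠ c₁ := by rintro rfl; exact hc.isolated₁ _ huw
  have : w ≠ c₃ := by rintro rfl; exact hc.isolated₃ _ huw.symm
  simp only [insertPath, SimpleGraph.sup_adj, SimpleGraph.edge_adj, SimpleGraph.deleteEdges_adj,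
    Set.mem_singleton_iff, Sym2.eq_iff]
  grind

/-- Sufficient condition for the graph obtained by inserting three vertices into a bridge `uw` to
have spectral radius less than `ρ`. The vector `y` is kept on the side of `u`, multiplied by
`t₁ t₂ t₃` on the side `A` of `w`, and takes on the new vertices the values that the eigenvalue
equation forces at them and at `w`; only the inequality at `u` remains to be checked. -/
theorem graphSpectralRadius_insertPath_lt {V : Type*} [Fintype V] {G : SimpleGraph V}
    {u w c₁ c₂ c₃ : V} (hc : IsolatedTriple G c₁ c₂ c₃) (huw : G.Adj u w) {A : Set V}
    (hwA : w ∈ A) (huA : u ∉ A)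
    (hA : ∀ q r, G.Adj q r → q ∈ A → r ∉ A → q = w ∧ r = u)
    (hconn : (insertPath G u w c₁ c₂ c₃).Connected) {y : V → ℝ} {ρ α t₁ t₂ t₃ : ℝ}
    (hy : ∀ q, 0 < y q) (hα : y w = α * y u) (ht₁ : 0 < t₁) (ht₂ : 0 < t₂) (ht₃ : 0 < t₃)
    (h₁ : t₁ * (ρ - α) = 1) (h₂ : t₂ * (ρ - t₁) = 1) (h₃ : t₃ * (ρ - t₂) = 1)
    (hle : ∀ q, q ≠ c₁ → q ≠ c₂ → q ≠ c₃ → q ≠ u → adjSum G y q ≤ ρ * y q)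
    (hu : adjSum G y u + (t₃ - α) * y u ≤ ρ * y u)
    (hlt : adjSum G y u + (t₃ - α) * y u < ρ * y u ∨
      ∃ q, q ≠ c₁ ∧ q ≠ c₂ ∧ q ≠ c₃ ∧ q ≠ u ∧ adjSum G y q < ρ * y q) :
    graphSpectralRadius (insertPath G u w c₁ c₂ c₃) < ρ := by
  classical
  have hadj := insertPath_adj hc huw
  obtain ⟨n12, n13, n23, i1, i2, i3⟩ := hc
  have huw' := huw.symm
  have hne : u ≠ w := huw.ne
  have u1 : u ≠ c₁ := by rintro rfl; exact i1 _ huw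
  have u2 : u ≠ c₂ := by rintro rfl; exact i2 _ huw
  have u3 : u ≠ c₃ := by rintro rfl; exact i3 _ huw
  have w1 : w ≠ c₁ := by rintro rfl; exact i1 _ huw'
  have w2 : w ≠ c₂ := by rintro rfl; exact i2 _ huw'
  have w3 : w ≠ c₃ := by rintro rfl; exact i3 _ huw'
  set κ : V → ℝ := fun q => if q ∈ A then t₁ * t₂ * t₃ else 1 with hκ
  have hκpos : ∀ q, 0 < κ q := fun q => by
    simp only [hκ]; split_ifs
    · positivity
    · exact one_pos
  have hκw : κ w = t₁ * t₂ * t₃ := by simp [hκ, hwA]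
  have hκu : κ u = 1 := by simp [hκ, huA]
  have hκadj : ∀ q r, G.Adj q r → ¬ (q = u ∧ r = w) → ¬ (q = w ∧ r = u) → κ r = κ q := by
    intro q r h h1 h2
    simp only [hκ]
    by_cases hq : q ∈ A <;> by_cases hr : r ∈ A
    · simp [hq, hr]
    · exact absurd (hA q r h hq hr) h2
    · exact absurd (hA r q h.symm hr hq).symm h1
    · simp [hq, hr]
  set y' : V → ℝ := fun q => if q = c₁ then t₃ * y u else if q = c₂ then t₂ * t₃ * y u
    else if q = c₃ then t₁ * t₂ * t₃ * y u else κ q * y q with hy'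
  have y'1 : y' c₁ = t₃ * y u := by simp [hy']
  have y'2 : y' c₂ = t₂ * t₃ * y u := by simp [hy', n12.symm]
  have y'3 : y' c₃ = t₁ * t₂ * t₃ * y u := by simp [hy', n13.symm, n23.symm]
  have y'q : ∀ q, q ≠ c₁ → q ≠ c₂ → q ≠ c₃ → y' q = κ q * y q := fun q a b c => by
    simp [hy', a, b, c]
  have y'u : y' u = y u := by rw [y'q u u1 u2 u3, hκu, one_mul]
  have y'w : y' w = t₁ * t₂ * t₃ * (α * y u) := by rw [y'q w w1 w2 w3, hκw, hα]
  have hyu := hy u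
  set H := insertPath G u w c₁ c₂ c₃
  have s1 : adjSum H y' c₁ = ρ * y' c₁ := by
    have : ∀ r, (if H.Adj c₁ r then y' r else 0)
        = (if r = u then y' u else 0) + (if r = c₂ then y' c₂ else 0) := by
      intro r; rw [hadj]; split_ifs <;> grind
    simp only [adjSum, this, Finset.sum_add_distrib, Finset.sum_ite_eq', Finset.mem_univ, if_true]
    rw [y'u, y'1, y'2]; linear_combination (-y u) * h₃
  have s2 : adjSum H y' c₂ = ρ * y' c₂ := by
    have : ∀ r, (if H.Adj c₂ r then y' r else 0)
        = (if r = c₁ then y' c₁ else 0) + (if r = c₃ then y' c₃ else 0) := by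
      intro r; rw [hadj]; split_ifs <;> grind
    simp only [adjSum, this, Finset.sum_add_distrib, Finset.sum_ite_eq', Finset.mem_univ, if_true]
    rw [y'3, y'1, y'2]; linear_combination (-t₃ * y u) * h₂
  have s3 : adjSum H y' c₃ = ρ * y' c₃ := by
    have : ∀ r, (if H.Adj c₃ r then y' r else 0)
        = (if r = c₂ then y' c₂ else 0) + (if r = w then y' w else 0) := by
      intro r; rw [hadj]; split_ifs <;> grind
    simp only [adjSum, this, Finset.sum_add_distrib, Finset.sum_ite_eq', Finset.mem_univ, if_true]
    rw [y'3, y'w, y'2]; linear_combination (-t₂ * t₃ * y u) * h₁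
  have hGr : ∀ q r, G.Adj q r → r ≠ c₁ ∧ r ≠ c₂ ∧ r ≠ c₃ := by
    intro q r h
    refine ⟨?_, ?_, ?_⟩ <;> rintro rfl
    exacts [i1 _ h.symm, i2 _ h.symm, i3 _ h.symm]
  have su : adjSum H y' u = adjSum G y u + (t₃ - α) * y u := by
    have : ∀ r, (if H.Adj u r then y' r else 0)
        = (if G.Adj u r then y r else 0) + (if r = c₁ then y' c₁ else 0)
          - (if r = w then y w else 0) := by
      intro r
      rw [hadj]
      by_cases hr : G.Adj u r
      · obtain ⟨a, b, c⟩ := hGr u r hr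
        by_cases hrw : r = w
        · subst hrw; simp [hr, hne, u1, u2, u3, a, b, c]
        · have hk := hκadj u r hr (fun h => hrw h.2) (fun h => hne h.1)
          simp [hr, hrw, hne, u1, u2, u3, a, b, c, y'q r a b c, hk, hκu]
      · by_cases hr1 : r = c₁
        · subst hr1; simp [hr, w1.symm]
        · have : r ≠ w := by rintro rfl; exact hr huw
          simp [hr, hr1, hne, u1, u2, u3, this]
    simp only [adjSum, this, Finset.sum_add_distrib, Finset.sum_sub_distrib, Finset.sum_ite_eq',
      Finset.mem_univ, if_true]
    rw [y'1, hα]; ring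
  have sw : adjSum H y' w = κ w * adjSum G y w := by
    have : ∀ r, (if H.Adj w r then y' r else 0)
        = κ w * (if G.Adj w r then y r else 0) + (if r = c₃ then y' c₃ else 0)
          - (if r = u then κ w * y u else 0) := by
      intro r
      rw [hadj]
      by_cases hr : G.Adj w r
      · obtain ⟨a, b, c⟩ := hGr w r hr
        by_cases hru : r = u
        · subst hru; simp [hr, hne.symm, w1, w2, w3, a, b, c]
        · have hk := hκadj w r hr (fun h => hne h.1.symm) (fun h => hru h.2)
          simp [hr, hru, hne.symm, w1, w2, w3, a, b, c, y'q r a b c, hk]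
      · by_cases hr1 : r = c₃
        · subst hr1; simp [hr, u3.symm]
        · have : r ≠ u := by rintro rfl; exact hr huw'
          simp [hr, hr1, hne.symm, w1, w2, w3, this]
    simp only [adjSum, this, Finset.sum_add_distrib, Finset.sum_sub_distrib, Finset.sum_ite_eq',
      Finset.mem_univ, if_true, ← Finset.mul_sum]
    rw [y'3, hκw]; ring
  have sq : ∀ q, q ≠ c₁ → q ≠ c₂ → q ≠ c₃ → q ≠ u → adjSum H y' q = κ q * adjSum G y q := by
    intro q a b c d
    by_cases hqw : q = w
    · rw [hqw, sw]
    rw [adjSum, adjSum, Finset.mul_sum]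
    refine Finset.sum_congr rfl fun r _ => ?_
    rw [hadj]
    by_cases hr : G.Adj q r
    · obtain ⟨a', b', c'⟩ := hGr q r hr
      have hk := hκadj q r hr (fun h => d h.1) (fun h => hqw h.1)
      simp [hr, a, b, c, d, hqw, y'q r a' b' c', hk]
    · simp [hr, a, b, c, d, hqw]
  have hub : ∀ q, q ≠ c₁ → q ≠ c₂ → q ≠ c₃ → q ≠ u → adjSum H y' q ≤ ρ * y' q := by
    intro q a b c d
    rw [sq q a b c d, y'q q a b c]
    nlinarith [mul_le_mul_of_nonneg_left (hle q a b c d) (hκpos q).le]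
  refine graphSpectralRadius_lt hconn (y := y') (fun q => ?_) (fun q => ?_) ?_
  · by_cases a : q = c₁
    · rw [a, s1]
    by_cases b : q = c₂
    · rw [b, s2]
    by_cases c : q = c₃
    · rw [c, s3]
    by_cases d : q = u
    · rw [d, su, y'u]; exact hu
    exact hub q a b c d
  · have := hκpos q
    have := hy q
    simp only [hy']
    split_ifs <;> positivity
  · rcases hlt with h | ⟨q, a, b, c, d, h⟩
    · exact ⟨u, by rw [su, y'u]; exact h⟩
    · refine ⟨q, ?_⟩
      rw [sq q a b c d, y'q q a b c]
      nlinarith [mul_lt_mul_of_pos_left h (hκpos q)]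

/-! ### Dissociation numbers -/

section Dissociation

variable {V : Type*} {G H : SimpleGraph V}

theorem isDissociationSet_iff {S : Finset V} : IsDissociationSet G S ↔
    ∀ v ∈ S, ∀ a ∈ S, ∀ b ∈ S, G.Adj v a → G.Adj v b → a = b := by
  simp only [IsDissociationSet, Set.encard_le_one_iff, SimpleGraph.mem_neighborSet,
    SimpleGraph.comap_adj, Function.Embedding.subtype_apply, Subtype.forall, Finset.mem_coe,
    Subtype.mk.injEq]

variable [Fintype V]

theorem bddAbove_card_isDissociationSet (G : SimpleGraph V) :
    BddAbove {m : ℕ | ∃ S : Finset V, IsDissociationSet G S ∧ S.card = m} :=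
  ⟨Fintype.card V, by rintro _ ⟨S, -, rfl⟩; exact S.card_le_univ⟩

theorem IsDissociationSet.card_le {S : Finset V} (hS : IsDissociationSet G S) :
    S.card ≤ dissociationNumber G :=
  le_csSup (bddAbove_card_isDissociationSet G) ⟨S, hS, rfl⟩

theorem exists_isDissociationSet_card_eq (G : SimpleGraph V) :
    ∃ S : Finset V, IsDissociationSet G S ∧ S.card = dissociationNumber G :=
  Nat.sSup_mem (s := {m : ℕ | ∃ S : Finset V, IsDissociationSet G S ∧ S.card = m})
    ⟨0, ∅, by simp [isDissociationSet_iff], rfl⟩ (bddAbove_card_isDissociationSet G)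

theorem dissociationNumber_add_le {d e : ℕ}
    (h : ∀ S : Finset V, IsDissociationSet G S →
      ∃ S' : Finset V, IsDissociationSet H S' ∧ S.card + d ≤ S'.card + e) :
    dissociationNumber G + d ≤ dissociationNumber H + e := by
  obtain ⟨S, hS, hcard⟩ := exists_isDissociationSet_card_eq G
  obtain ⟨S', hS', hle⟩ := h S hS
  have := hS'.card_le
  omega

theorem card_sdiff_union_of_subset {α : Type*} [DecidableEq α] {S C D : Finset α} (h : D ⊆ C) :
    (S \ C ∪ D).card + (S ∩ C).card = S.card + D.card := by
  rw [Finset.card_union_of_disjoint (Finset.disjoint_of_subset_right h Finset.sdiff_disjoint),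
    ← Finset.card_sdiff_add_card_inter S C]
  omega

theorem dissociationNumber_attachPath {z c₁ c₂ c₃ : V} (hc : IsolatedTriple G c₁ c₂ c₃)
    (hz : z ≠ c₁ ∧ z ≠ c₂ ∧ z ≠ c₃) :
    dissociationNumber (attachPath G z c₁ c₂ c₃) + 1 = dissociationNumber G := by
  classical
  have hadj := attachPath_adj hc hz.1
  obtain ⟨z1, z2, z3⟩ := hz
  obtain ⟨n12, n13, n23, i1, i2, i3⟩ := hc
  have i1' : ∀ r, ¬ G.Adj r c₁ := fun r h => i1 r h.symm
  have i2' : ∀ r, ¬ G.Adj r c₂ := fun r h => i2 r h.symm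
  have i3' : ∀ r, ¬ G.Adj r c₃ := fun r h => i3 r h.symm
  have hC : ({c₁, c₂, c₃} : Finset V).card = 3 :=
    Finset.card_eq_three.2 ⟨_, _, _, n12, n13, n23, rfl⟩
  have hle3 : ∀ S : Finset V, (S ∩ {c₁, c₂, c₃}).card ≤ 3 := fun S =>
    (Finset.card_le_card Finset.inter_subset_right).trans hC.le
  refine le_antisymm ?_ ?_
  · refine dissociationNumber_add_le (e := 0) fun S hS =>
      ⟨S \ {c₁, c₂, c₃} ∪ {c₁, c₂, c₃}, ?_, ?_⟩
    · rw [isDissociationSet_iff] at hS ⊢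
      intro v hv a ha b hb hva hvb
      simp only [Finset.mem_union, Finset.mem_sdiff, Finset.mem_insert, Finset.mem_singleton]
        at hv ha hb
      refine hS v ?_ a ?_ b ?_ ((hadj _ _).2 (Or.inl hva)) ((hadj _ _).2 (Or.inl hvb)) <;> grind
    · have h2 : (S ∩ {c₁, c₂, c₃}).card ≤ 2 := by
        by_contra hlt
        have hsub : S ∩ {c₁, c₂, c₃} = {c₁, c₂, c₃} :=
          Finset.eq_of_subset_of_card_le Finset.inter_subset_right (by omega)
        rw [Finset.inter_eq_right] at hsub
        rw [isDissociationSet_iff] at hS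
        exact n13 (hS c₂ (hsub (by simp)) c₁ (hsub (by simp)) c₃ (hsub (by simp))
          ((hadj _ _).2 (by simp)) ((hadj _ _).2 (by simp)))
      have := card_sdiff_union_of_subset (S := S) (Finset.Subset.refl ({c₁, c₂, c₃} : Finset V))
      omega
  · refine dissociationNumber_add_le (d := 0) fun S hS =>
      ⟨S \ {c₁, c₂, c₃} ∪ {c₂, c₃}, ?_, ?_⟩
    · rw [isDissociationSet_iff] at hS ⊢
      intro v hv a ha b hb hva hvb
      simp only [Finset.mem_union, Finset.mem_sdiff, Finset.mem_insert, Finset.mem_singleton]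
        at hv ha hb
      rw [hadj] at hva hvb
      grind
    · have := card_sdiff_union_of_subset (S := S)
        (show ({c₂, c₃} : Finset V) ⊆ {c₁, c₂, c₃} by simp)
      have := Finset.card_pair n23
      have := hle3 S
      omega

theorem dissociationNumber_insertPath_add_one_le {u w c₁ c₂ c₃ : V}
    (hc : IsolatedTriple G c₁ c₂ c₃)
    (huw : G.Adj u w) :
    dissociationNumber (insertPath G u w c₁ c₂ c₃) + 1 ≤ dissociationNumber G := by
  classical
  have hadj := insertPath_adj hc huw
  obtain ⟨n12, n13, n23, i1, i2, i3⟩ := hc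
  have i1' : ∀ r, ¬ G.Adj r c₁ := fun r h => i1 r h.symm
  have i2' : ∀ r, ¬ G.Adj r c₂ := fun r h => i2 r h.symm
  have i3' : ∀ r, ¬ G.Adj r c₃ := fun r h => i3 r h.symm
  have hirr : ∀ q, ¬ G.Adj q q := fun q => G.irrefl
  have hC : ({c₁, c₂, c₃} : Finset V).card = 3 :=
    Finset.card_eq_three.2 ⟨_, _, _, n12, n13, n23, rfl⟩
  refine dissociationNumber_add_le (e := 0) fun S hS => ?_
  rw [isDissociationSet_iff] at hS
  have h2 : (S ∩ {c₁, c₂, c₃}).card ≤ 2 := by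
    by_contra hlt
    have hsub : S ∩ {c₁, c₂, c₃} = {c₁, c₂, c₃} :=
      Finset.eq_of_subset_of_card_le Finset.inter_subset_right (by omega)
    rw [Finset.inter_eq_right] at hsub
    exact n13 (hS c₂ (hsub (by simp)) c₁ (hsub (by simp)) c₃ (hsub (by simp))
      ((hadj _ _).2 (by simp)) ((hadj _ _).2 (by simp)))
  have h0 := card_sdiff_union_of_subset (S := S) (Finset.Subset.refl ({c₁, c₂, c₃} : Finset V))
  by_cases hbad : u ∈ S ∧ w ∈ S ∧ (S ∩ {c₁, c₂, c₃}).card ≤ 1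
  · -- Restoring the edge `uw` may create a vertex of degree two: `u` is given up.
    refine ⟨(S \ {c₁, c₂, c₃} ∪ {c₁, c₂, c₃}).erase u, ?_, ?_⟩
    · rw [isDissociationSet_iff]
      intro v hv a ha b hb hva hvb
      simp only [Finset.mem_erase, Finset.mem_union, Finset.mem_sdiff, Finset.mem_insert,
        Finset.mem_singleton] at hv ha hb
      refine hS v ?_ a ?_ b ?_ ((hadj _ _).2 (Or.inl ⟨hva, ?_⟩))
        ((hadj _ _).2 (Or.inl ⟨hvb, ?_⟩)) <;> grind
    · have := Finset.pred_card_le_card_erase (s := S \ {c₁, c₂, c₃} ∪ {c₁, c₂, c₃}) (a := u)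
      omega
  · refine ⟨S \ {c₁, c₂, c₃} ∪ {c₁, c₂, c₃}, ?_, by omega⟩
    -- If `u` and `w` both belong to `S`, then so do `c₁` and `c₃`, which use up the only
    -- neighbours that `u` and `w` may have in `S`.
    have hends : u ∈ S → w ∈ S → c₁ ∈ S ∧ c₃ ∈ S := by
      intro hu hw
      by_contra hn
      have hlt : 1 < (S ∩ {c₁, c₂, c₃}).card := by
        by_contra h; exact hbad ⟨hu, hw, by omega⟩
      obtain ⟨p, hp, q, hq, hpq⟩ := Finset.one_lt_card.1 hlt
      simp only [Finset.mem_inter, Finset.mem_insert, Finset.mem_singleton] at hp hq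
      have hc2 : c₂ ∈ S := by grind
      have : c₁ ∈ S ∨ c₃ ∈ S := by grind
      rcases this with h | h
      · have : u = c₂ := hS c₁ h u hu c₂ hc2 ((hadj _ _).2 (by simp)) ((hadj _ _).2 (by simp))
        subst this; exact i2 _ huw
      · have : w = c₂ := hS c₃ h w hw c₂ hc2 ((hadj _ _).2 (by simp)) ((hadj _ _).2 (by simp))
        subst this; exact i2 _ huw.symm
    have hu' : u ∈ S → w ∈ S → ∀ r ∈ S, G.Adj u r → r = w := by
      intro hu hw r hr h
      by_contra hrw
      have : r = c₁ := hS u hu r hr c₁ (hends hu hw).1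
        ((hadj _ _).2 (Or.inl ⟨h, by tauto, by rintro ⟨rfl, _⟩; exact hirr _ huw⟩))
        ((hadj _ _).2 (by simp))
      subst this; exact i1' _ h
    have hw' : u ∈ S → w ∈ S → ∀ r ∈ S, G.Adj w r → r = u := by
      intro hu hw r hr h
      by_contra hrw
      have : r = c₃ := hS w hw r hr c₃ (hends hu hw).2
        ((hadj _ _).2 (Or.inl ⟨h, by rintro ⟨rfl, _⟩; exact hirr _ huw, by tauto⟩))
        ((hadj _ _).2 (by simp))
      subst this; exact i3' _ h
    rw [isDissociationSet_iff]
    intro v hv a ha b hb hva hvb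
    simp only [Finset.mem_union, Finset.mem_sdiff, Finset.mem_insert,
      Finset.mem_singleton] at hv ha hb
    have hvS : v ∈ S := by grind
    have haS : a ∈ S := by grind
    have hbS : b ∈ S := by grind
    by_cases h1 : (v = u ∧ a = w) ∨ (v = w ∧ a = u) ∨ (v = u ∧ b = w) ∨ (v = w ∧ b = u)
    · grind
    · refine hS v hvS a haS b hbS ((hadj _ _).2 (Or.inl ⟨hva, ?_⟩))
        ((hadj _ _).2 (Or.inl ⟨hvb, ?_⟩))
      · exact ⟨fun h => h1 (Or.inl h), fun h => h1 (Or.inr (Or.inl h))⟩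
      · exact ⟨fun h => h1 (Or.inr (Or.inr (Or.inl h))),
          fun h => h1 (Or.inr (Or.inr (Or.inr h)))⟩

theorem dissociationNumber_le_insertPath_add_one {u w c₁ c₂ c₃ : V}
    (hc : IsolatedTriple G c₁ c₂ c₃)
    (huw : G.Adj u w) :
    dissociationNumber G ≤ dissociationNumber (insertPath G u w c₁ c₂ c₃) + 1 := by
  classical
  have hadj := insertPath_adj hc huw
  obtain ⟨n12, n13, n23, i1, i2, i3⟩ := hc
  have i1' : ∀ r, ¬ G.Adj r c₁ := fun r h => i1 r h.symm
  have i2' : ∀ r, ¬ G.Adj r c₂ := fun r h => i2 r h.symm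
  have i3' : ∀ r, ¬ G.Adj r c₃ := fun r h => i3 r h.symm
  have hirr : ∀ q, ¬ G.Adj q q := fun q => G.irrefl
  have hC : ({c₁, c₂, c₃} : Finset V).card = 3 :=
    Finset.card_eq_three.2 ⟨_, _, _, n12, n13, n23, rfl⟩
  have hle3 : ∀ S : Finset V, (S ∩ {c₁, c₂, c₃}).card ≤ 3 := fun S =>
    (Finset.card_le_card Finset.inter_subset_right).trans hC.le
  refine dissociationNumber_add_le (d := 0) fun S hS => ?_
  rw [isDissociationSet_iff] at hS
  suffices ∃ D : Finset V, D ⊆ {c₁, c₂, c₃} ∧ D.card = 2 ∧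
      IsDissociationSet (insertPath G u w c₁ c₂ c₃) (S \ {c₁, c₂, c₃} ∪ D) by
    obtain ⟨D, hD, hcard, h⟩ := this
    refine ⟨_, h, ?_⟩
    have := card_sdiff_union_of_subset (S := S) hD
    have := hle3 S
    omega
  have hwu := huw.symm
  by_cases hu : u ∈ S <;> by_cases hw : w ∈ S
  · refine ⟨{c₁, c₃}, by grind, Finset.card_pair n13, ?_⟩
    have hu' : ∀ r ∈ S, G.Adj u r → r = w := fun r hr h => hS u hu r hr w hw h huw
    have hw' : ∀ r ∈ S, G.Adj w r → r = u := fun r hr h => hS w hw r hr u hu h hwu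
    rw [isDissociationSet_iff]
    intro v hv a ha b hb hva hvb
    simp only [Finset.mem_union, Finset.mem_sdiff, Finset.mem_insert, Finset.mem_singleton]
      at hv ha hb
    rw [hadj] at hva hvb
    grind
  · refine ⟨{c₂, c₃}, by grind, Finset.card_pair n23, ?_⟩
    rw [isDissociationSet_iff]
    intro v hv a ha b hb hva hvb
    simp only [Finset.mem_union, Finset.mem_sdiff, Finset.mem_insert, Finset.mem_singleton]
      at hv ha hb
    rw [hadj] at hva hvb
    grind
  all_goals
    refine ⟨{c₁, c₂}, by grind, Finset.card_pair n12, ?_⟩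
    rw [isDissociationSet_iff]
    intro v hv a ha b hb hva hvb
    simp only [Finset.mem_union, Finset.mem_sdiff, Finset.mem_insert, Finset.mem_singleton]
      at hv ha hb
    rw [hadj] at hva hvb
    grind

theorem dissociationNumber_insertPath {u w c₁ c₂ c₃ : V} (hc : IsolatedTriple G c₁ c₂ c₃)
    (huw : G.Adj u w) :
    dissociationNumber (insertPath G u w c₁ c₂ c₃) + 1 = dissociationNumber G :=
  le_antisymm (dissociationNumber_insertPath_add_one_le hc huw)
    (dissociationNumber_le_insertPath_add_one hc huw)

end Dissociation

/-! ### Connectivity -/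

section Connectivity

variable {V : Type*} {G H : SimpleGraph V}

/-- A map sending adjacent vertices of `G` to vertices reachable from each other in `H` preserves
reachability. -/
theorem SimpleGraph.Reachable.of_forall_adj {f : V → V}
    (h : ∀ q r, G.Adj q r → H.Reachable (f q) (f r)) {q r : V} (hqr : G.Reachable q r) :
    H.Reachable (f q) (f r) := by
  obtain ⟨p⟩ := hqr
  induction p with
  | nil => exact SimpleGraph.Reachable.refl _
  | cons h' _ ih => exact (h _ _ h').trans ih

open Classical in
theorem reachable_of_attachPath_connected {z c₁ c₂ c₃ : V} (hc : IsolatedTriple G c₁ c₂ c₃)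
    (hz : z ≠ c₁ ∧ z ≠ c₂ ∧ z ≠ c₃) (hconn : (attachPath G z c₁ c₂ c₃).Connected) {q r : V}
    (hq : q ≠ c₁ ∧ q ≠ c₂ ∧ q ≠ c₃) (hr : r ≠ c₁ ∧ r ≠ c₂ ∧ r ≠ c₃) : G.Reachable q r := by
  have hadj := attachPath_adj hc hz.1
  have key := SimpleGraph.Reachable.of_forall_adj (H := G)
    (f := fun q => if q = c₁ ∨ q = c₂ ∨ q = c₃ then z else q) (fun q r h => ?_)
    (hconn.preconnected q r)
  · simpa [hq, hr] using key
  · rw [hadj] at h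
    rcases h with h | h | h | h | h | h | h
    · have hq : q ≠ c₁ ∧ q ≠ c₂ ∧ q ≠ c₃ := by
        refine ⟨?_, ?_, ?_⟩ <;> rintro rfl
        exacts [hc.isolated₁ _ h, hc.isolated₂ _ h, hc.isolated₃ _ h]
      have hr : r ≠ c₁ ∧ r ≠ c₂ ∧ r ≠ c₃ := by
        refine ⟨?_, ?_, ?_⟩ <;> rintro rfl
        exacts [hc.isolated₁ _ h.symm, hc.isolated₂ _ h.symm, hc.isolated₃ _ h.symm]
      simpa [hq, hr] using h.reachable
    all_goals
      obtain ⟨rfl, rfl⟩ := h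
      simp

open Classical in
theorem reachable_of_insertPath_connected {u w c₁ c₂ c₃ : V} (hc : IsolatedTriple G c₁ c₂ c₃)
    (huw : G.Adj u w) (hconn : (insertPath G u w c₁ c₂ c₃).Connected) {q r : V}
    (hq : q ≠ c₁ ∧ q ≠ c₂ ∧ q ≠ c₃) (hr : r ≠ c₁ ∧ r ≠ c₂ ∧ r ≠ c₃) : G.Reachable q r := by
  have hadj := insertPath_adj hc huw
  have hG : ∀ q r, G.Adj q r → q ≠ c₁ ∧ q ≠ c₂ ∧ q ≠ c₃ := by
    intro q r h
    refine ⟨?_, ?_, ?_⟩ <;> rintro rfl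
    exacts [hc.isolated₁ _ h, hc.isolated₂ _ h, hc.isolated₃ _ h]
  have hu := hG _ _ huw
  have hw := hG _ _ huw.symm
  have key := SimpleGraph.Reachable.of_forall_adj (H := G)
    (f := fun q => if q = c₁ ∨ q = c₂ ∨ q = c₃ then u else q) (fun q r h => ?_)
    (hconn.preconnected q r)
  · simpa [hq, hr] using key
  · rw [hadj] at h
    rcases h with h | h | h | h | h | h | h | h | h
    · simpa [hG _ _ h.1, hG _ _ h.1.symm] using h.1.reachable
    all_goals
      obtain ⟨rfl, rfl⟩ := h
      simp [hu, hw, huw.reachable, huw.symm.reachable]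

theorem insertPath_connected {u w c₁ c₂ c₃ : V} (hc : IsolatedTriple G c₁ c₂ c₃)
    (huw : G.Adj u w)
    (hG : ∀ q r, (q ≠ c₁ ∧ q ≠ c₂ ∧ q ≠ c₃) → (r ≠ c₁ ∧ r ≠ c₂ ∧ r ≠ c₃) → G.Reachable q r) :
    (insertPath G u w c₁ c₂ c₃).Connected := by
  have hadj := insertPath_adj hc huw
  set H := insertPath G u w c₁ c₂ c₃
  have a1 : H.Adj u c₁ := (hadj _ _).2 (by simp)
  have a2 : H.Adj c₁ c₂ := (hadj _ _).2 (by simp)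
  have a3 : H.Adj c₂ c₃ := (hadj _ _).2 (by simp)
  have a4 : H.Adj c₃ w := (hadj _ _).2 (by simp)
  have r1 := a1.reachable
  have r2 := r1.trans a2.reachable
  have r3 := r2.trans a3.reachable
  have r4 := r3.trans a4.reachable
  have hu : u ≠ c₁ ∧ u ≠ c₂ ∧ u ≠ c₃ := by
    refine ⟨?_, ?_, ?_⟩ <;> rintro rfl
    exacts [hc.isolated₁ _ huw, hc.isolated₂ _ huw, hc.isolated₃ _ huw]
  have hstep : ∀ q r, G.Adj q r → H.Reachable q r := by
    intro q r h
    by_cases h1 : q = u ∧ r = w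
    · obtain ⟨rfl, rfl⟩ := h1; exact r4
    by_cases h2 : q = w ∧ r = u
    · obtain ⟨rfl, rfl⟩ := h2; exact r4.symm
    exact ((hadj _ _).2 (Or.inl ⟨h, h1, h2⟩)).reachable
  have hroot : ∀ q, H.Reachable u q := by
    intro q
    by_cases q1 : q = c₁
    · rw [q1]; exact r1
    by_cases q2 : q = c₂
    · rw [q2]; exact r2
    by_cases q3 : q = c₃
    · rw [q3]; exact r3
    exact SimpleGraph.Reachable.of_forall_adj (f := id) hstep (hG u q hu ⟨q1, q2, q3⟩)
  have : Nonempty V := ⟨u⟩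
  exact ⟨fun q r => (hroot q).symm.trans (hroot r)⟩

end Connectivity

/-! ### Sums over neighbours -/

section Neighbours

variable {V : Type*} [Fintype V] {G : SimpleGraph V}

theorem sum_le_adjSum {x : V → ℝ} (hx : ∀ q, 0 ≤ x q) {q : V} (s : Finset V)
    (hs : ∀ r ∈ s, G.Adj q r) : ∑ r ∈ s, x r ≤ adjSum G x q := by
  classical
  calc ∑ r ∈ s, x r = ∑ r ∈ s, if G.Adj q r then x r else 0 :=
        Finset.sum_congr rfl fun r hr => by rw [if_pos (hs r hr)]
    _ ≤ adjSum G x q := Finset.sum_le_univ_sum_of_nonneg fun r => by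
        split_ifs
        exacts [hx r, le_rfl]

theorem le_adjSum {x : V → ℝ} (hx : ∀ q, 0 ≤ x q) {q r : V} (h : G.Adj q r) :
    x r ≤ adjSum G x q := by
  simpa using sum_le_adjSum hx {r} (by simpa using h)

theorem add_le_adjSum {x : V → ℝ} (hx : ∀ q, 0 ≤ x q) {q r s : V} (h : G.Adj q r)
    (h' : G.Adj q s) (hne : r ≠ s) : x r + x s ≤ adjSum G x q := by
  classical
  have := sum_le_adjSum hx {r, s} (q := q) (G := G) (by simp [h, h'])
  rwa [Finset.sum_pair hne] at this

theorem add_add_le_adjSum {x : V → ℝ} (hx : ∀ q, 0 ≤ x q) {q r s t : V} (h : G.Adj q r)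
    (h' : G.Adj q s) (h'' : G.Adj q t) (hrs : r ≠ s) (hrt : r ≠ t) (hst : s ≠ t) :
    x r + x s + x t ≤ adjSum G x q := by
  classical
  have := sum_le_adjSum hx {r, s, t} (q := q) (G := G) (by simp [h, h', h''])
  rw [Finset.sum_insert (by simp [hrs, hrt]), Finset.sum_pair hst] at this
  linarith

theorem adjSum_of_adj_iff_eq {q v : V} (h : ∀ r, G.Adj q r ↔ r = v) (x : V → ℝ) :
    adjSum G x q = x v := by
  classical
  simp [adjSum, h]

theorem adjSum_of_adj_iff_or {q v w : V} (h : ∀ r, G.Adj q r ↔ r = v ∨ r = w) (hne : v ≠ w)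
    (x : V → ℝ) : adjSum G x q = x v + x w := by
  classical
  have : ∀ r, (if G.Adj q r then x r else 0)
      = (if r = v then x v else 0) + (if r = w then x w else 0) := by
    intro r; rw [h]; split_ifs <;> grind
  simp [adjSum, this, Finset.sum_add_distrib]

end Neighbours

/-! ### Legs -/

section Legs

variable {V : Type*}

/-- `Leg G v a m`: the vertex `a` is adjacent to `v`, and the part of `G` beyond `a` as seen from
`v` is a pendant path with `m` edges starting at `a`. -/
inductive Leg (G : SimpleGraph V) : V → V → ℕ → Prop
  | leaf {v a : V} (h : ∀ r, G.Adj a r ↔ r = v) : Leg G v a 0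
  | cons {v a a' : V} {m : ℕ} (hne : a' ≠ v) (h : ∀ r, G.Adj a r ↔ r = v ∨ r = a')
      (hleg : Leg G a a' m) : Leg G v a (m + 1)

variable {G : SimpleGraph V}

theorem Leg.adj {v a : V} {m : ℕ} (h : Leg G v a m) : G.Adj v a := by
  cases h with
  | leaf h => exact ((h v).2 rfl).symm
  | cons _ h _ => exact ((h v).2 (Or.inl rfl)).symm

theorem leg_of_walk {v a b : V} (p : G.Walk a b) (hp : p.IsPath) (hva : G.Adj v a)
    (hv : v ∉ p.support) (hdeg : ∀ u ∈ p.support, u ≠ b → (G.neighborSet u).encard = 2)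
    (hb : (G.neighborSet b).encard = 1) : Leg G v a p.length := by
  induction p generalizing v with
  | nil =>
    obtain ⟨w, hw⟩ := Set.encard_eq_one.1 hb
    have hiff : ∀ r, G.Adj _ r ↔ r = w := fun r => by
      rw [← SimpleGraph.mem_neighborSet, hw, Set.mem_singleton_iff]
    refine Leg.leaf fun r => ?_
    rw [hiff, (hiff v).1 hva.symm]
  | @cons a a' b h p ih =>
    rw [SimpleGraph.Walk.cons_isPath_iff] at hp
    have ha : a ≠ b := fun hab => hp.2 (hab ▸ p.end_mem_support)
    have hv' : a' ≠ v := by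
      rintro rfl; exact hv (by simp)
    obtain ⟨w, w', -, hw⟩ := Set.encard_eq_two.1 (hdeg a (by simp) ha)
    have hiff : ∀ r, G.Adj a r ↔ r = w ∨ r = w' := fun r => by
      rw [← SimpleGraph.mem_neighborSet, hw]; simp
    refine Leg.cons hv' (fun r => ?_)
      (ih hp.1 h hp.2 (fun u hu => hdeg u (by simp [hu])) hb)
    have h1 := (hiff v).1 hva.symm
    have h2 := (hiff a').1 h
    rw [hiff]
    grind

theorem IsBranchPath.leg {v a b : V} {p : G.Walk a b} (h : IsBranchPath G v p) :
    Leg G v a p.length := by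
  refine leg_of_walk p h.isPath h.attached (fun hv => ?_) h.degree_eq_two h.leaf
  have hlt := h.branch
  by_cases hvb : v = b
  · rw [hvb, h.leaf] at hlt; exact absurd hlt (by decide)
  · rw [h.degree_eq_two v hv hvb] at hlt; exact lt_irrefl _ hlt

/-- In a tree, a leg issues in every direction from a vertex `v` such that all other vertices have
degree at most two: a path starting at `v` can be extended until it reaches a leaf. -/
theorem exists_leg_of_isAcyclic [Fintype V] (hG : G.IsAcyclic) {v d : V}
    (hdeg : ∀ r, r ≠ v → (G.neighborSet r).encard ≤ 2) (hd : G.Adj v d) :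
    ∃ m, Leg G v d m := by
  suffices H : ∀ (k : ℕ) (u a : V) (p : G.Walk v u) (h : G.Adj u a), (p.concat h).IsPath →
      Fintype.card V ≤ p.length + k → ∃ m, Leg G u a m by
    refine H (Fintype.card V) v d .nil hd ?_ (by simp)
    simpa [SimpleGraph.Walk.concat] using hd.ne
  intro k
  induction k with
  | zero =>
    intro u a p h hp hk
    have := hp.length_lt
    rw [SimpleGraph.Walk.length_concat] at this
    omega
  | succ k ih =>
    intro u a p h hp hk
    have hav : a ≠ v := by
      rintro rfl
      rw [SimpleGraph.Walk.concat_isPath_iff] at hp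
      exact hp.2 p.start_mem_support
    by_cases hleaf : ∀ r, G.Adj a r → r = u
    · exact ⟨0, Leg.leaf fun r => ⟨hleaf r, by rintro rfl; exact h.symm⟩⟩
    push Not at hleaf
    obtain ⟨a', ha', hne⟩ := hleaf
    have hiff : ∀ r, G.Adj a r ↔ r = u ∨ r = a' := by
      intro r
      refine ⟨fun hr => ?_, by rintro (rfl | rfl) <;> [exact h.symm; exact ha']⟩
      by_contra hcon
      push Not at hcon
      have hsub : ({r, u, a'} : Set V) ⊆ G.neighborSet a := by
        rintro s (rfl | rfl | rfl)
        exacts [hr, h.symm, ha']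
      have h3 : ({r, u, a'} : Set V).encard = 3 :=
        Set.encard_eq_three.2 ⟨_, _, _, hcon.1, hcon.2, hne.symm, rfl⟩
      have := (Set.encard_le_encard hsub).trans (hdeg a hav)
      rw [h3] at this
      exact absurd this (by decide)
    have hp' : ((p.concat h).concat ha').IsPath := by
      rw [SimpleGraph.Walk.concat_isPath_iff]
      refine ⟨hp, fun hmem => hne ?_⟩
      have := hG.eq_penultimate_of_adj_end hp ha' hmem
      simpa using this
    obtain ⟨m, hm⟩ := ih a a' (p.concat h) ha' hp' (by
      rw [SimpleGraph.Walk.length_concat]; omega)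
    exact ⟨m + 1, Leg.cons hne hiff hm⟩

/-- The last three vertices `c₁`, `c₂`, `c₃` of a leg with at least three vertices, and the
predecessor `z` of `c₁`. -/
structure PendantTriple (G : SimpleGraph V) (z c₁ c₂ c₃ : V) : Prop where
  ne : c₁ ≠ c₃
  ne' : z ≠ c₂
  adj₁ : ∀ r, G.Adj c₁ r ↔ r = z ∨ r = c₂
  adj₂ : ∀ r, G.Adj c₂ r ↔ r = c₁ ∨ r = c₃
  adj₃ : ∀ r, G.Adj c₃ r ↔ r = c₂

theorem Leg.exists_pendantTriple {v a : V} {m : ℕ} (h : Leg G v a m) (hm : 2 ≤ m) :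
    ∃ z c₁ c₂ c₃, PendantTriple G z c₁ c₂ c₃ := by
  induction h with
  | leaf => omega
  | @cons v a a' m hne h hleg ih =>
    by_cases hm' : 2 ≤ m
    · exact ih hm'
    obtain rfl : m = 1 := by omega
    cases hleg with
    | @cons _ _ a'' _ hne' h' hleg' =>
      cases hleg' with
      | leaf h'' => exact ⟨v, a, a', a'', hne'.symm, hne.symm, h, h', h''⟩

/-- Along a leg, a positive eigenvector for `ρ ≥ 2` decreases, and its values are strictly
log-concave, because `x v ^ 2 - ρ * x v * x a + x a ^ 2` does not change along the leg. -/
theorem Leg.eigenvector_lt [Fintype V] {v a : V} {m : ℕ} (h : Leg G v a m) {x : V → ℝ} {ρ : ℝ}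
    (hx : ∀ q, 0 < x q) (heig : ∀ q, adjSum G x q = ρ * x q) (hρ : 2 ≤ ρ) :
    x a < x v ∧ 0 < x v ^ 2 - ρ * x v * x a + x a ^ 2 := by
  induction h with
  | @leaf v a h =>
    have h1 : x v = ρ * x a := by rw [← heig, adjSum_of_adj_iff_eq h]
    have h2 := hx a
    constructor
    · nlinarith
    · rw [h1]; nlinarith
  | @cons v a a' m hne h hleg ih =>
    have h1 : x v + x a' = ρ * x a := by rw [← heig, adjSum_of_adj_iff_or h hne.symm]
    have h2 := hx a
    have h3 : x v = ρ * x a - x a' := by linarith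
    obtain ⟨i1, i2⟩ := ih
    constructor
    · nlinarith
    · rw [h3]; nlinarith

end Legs

/-! ### Bridges of forests -/

section Bridge

variable {V : Type*} {G : SimpleGraph V}

/-- The side of `w` in a tree from which the edge `uw` is removed. -/
theorem exists_side_of_isAcyclic (hG : G.IsAcyclic) {u w : V} (huw : G.Adj u w) :
    ∃ A : Set V, w ∈ A ∧ u ∉ A ∧ ∀ q r, G.Adj q r → q ∈ A → r ∉ A → q = w ∧ r = u := by
  have hb := SimpleGraph.isAcyclic_iff_forall_adj_isBridge.1 hG huw
  rw [SimpleGraph.isBridge_iff] at hb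
  refine ⟨{q | (G.deleteEdges {s(u, w)}).Reachable w q}, .refl _,
    fun h => hb h.symm, ?_⟩
  intro q r hqr hq hr
  by_contra hne
  by_cases h2 : q = u ∧ r = w
  · exact hr (h2.2 ▸ .refl _)
  refine hr (SimpleGraph.Reachable.trans hq (SimpleGraph.Adj.reachable ?_))
  simp only [SimpleGraph.deleteEdges_adj, Set.mem_singleton_iff, Sym2.eq_iff]
  tauto

end Bridge

/-! ### Removing the end of a leg -/

section Isolate

variable {V : Type*}

/-- The graph on the same vertices in which the edges meeting `C` are removed. -/
def isolate (G : SimpleGraph V) (C : Set V) : SimpleGraph V where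
  Adj q r := G.Adj q r ∧ q ∉ C ∧ r ∉ C
  symm := ⟨fun _ _ h => ⟨h.1.symm, h.2.2, h.2.1⟩⟩
  loopless := ⟨fun _ h => G.irrefl h.1⟩

variable {G : SimpleGraph V}

theorem isolate_adj {C : Set V} {q r : V} :
    (isolate G C).Adj q r ↔ G.Adj q r ∧ q ∉ C ∧ r ∉ C := Iff.rfl

theorem PendantTriple.ne_end {z c₁ c₂ c₃ : V} (h : PendantTriple G z c₁ c₂ c₃) :
    z ≠ c₁ ∧ z ≠ c₂ ∧ z ≠ c₃ := by
  have h1 : G.Adj c₁ z := (h.adj₁ z).2 (Or.inl rfl)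
  refine ⟨h1.ne', h.ne', ?_⟩
  rintro rfl
  have := (h.adj₃ c₁).1 h1.symm
  exact G.irrefl (this ▸ (h.adj₁ c₂).2 (Or.inr rfl))

theorem PendantTriple.isolatedTriple {z c₁ c₂ c₃ : V} (h : PendantTriple G z c₁ c₂ c₃) :
    IsolatedTriple (isolate G {c₁, c₂, c₃}) c₁ c₂ c₃ where
  ne₁₂ := ((h.adj₁ c₂).2 (Or.inr rfl)).ne
  ne₁₃ := h.ne
  ne₂₃ := ((h.adj₂ c₃).2 (Or.inr rfl)).ne
  isolated₁ := by simp [isolate_adj]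
  isolated₂ := by simp [isolate_adj]
  isolated₃ := by simp [isolate_adj]

theorem PendantTriple.attachPath_eq {z c₁ c₂ c₃ : V} (h : PendantTriple G z c₁ c₂ c₃) :
    attachPath (isolate G {c₁, c₂, c₃}) z c₁ c₂ c₃ = G := by
  ext q r
  rw [attachPath_adj h.isolatedTriple h.ne_end.1, isolate_adj]
  have h1 := h.adj₁
  have h2 := h.adj₂
  have h3 := h.adj₃
  have hs : G.Adj q r ↔ G.Adj r q := G.adj_comm q r
  simp only [Set.mem_insert_iff, Set.mem_singleton_iff]
  by_cases q1 : q = c₁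
  · subst q1; rw [h1]; have := h.isolatedTriple.ne₁₂; have := h.ne; have := h.ne_end; grind
  by_cases q2 : q = c₂
  · subst q2; rw [h2]; have := h.isolatedTriple.ne₂₃; have := h.ne_end; grind
  by_cases q3 : q = c₃
  · subst q3; rw [h3]; have := h.ne_end; grind
  by_cases r1 : r = c₁
  · subst r1; rw [hs, h1]; grind
  by_cases r2 : r = c₂
  · subst r2; rw [hs, h2]; grind
  by_cases r3 : r = c₃
  · subst r3; rw [hs, h3]; grind
  grind

open Classical in
theorem PendantTriple.adjSum_isolate [Fintype V] {z c₁ c₂ c₃ : V}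
    (h : PendantTriple G z c₁ c₂ c₃) (x : V → ℝ) {q : V} (hq : q ≠ c₁ ∧ q ≠ c₂ ∧ q ≠ c₃) :
    adjSum (isolate G {c₁, c₂, c₃}) x q = adjSum G x q - if q = z then x c₁ else 0 := by
  have hterm : ∀ r, (if (isolate G {c₁, c₂, c₃}).Adj q r then x r else 0)
      = (if G.Adj q r then x r else 0)
        - (if r = c₁ then (if q = z then x c₁ else 0) else 0) := by
    intro r
    have hs : G.Adj q r ↔ G.Adj r q := G.adj_comm q r
    simp only [isolate_adj, Set.mem_insert_iff, Set.mem_singleton_iff]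
    by_cases r1 : r = c₁
    · subst r1; rw [hs, h.adj₁]; grind
    by_cases r2 : r = c₂
    · subst r2; rw [hs, h.adj₂]; grind
    by_cases r3 : r = c₃
    · subst r3; rw [hs, h.adj₃]; grind
    simp [hq, r1, r2, r3]
  simp only [adjSum, hterm, Finset.sum_sub_distrib, Finset.sum_ite_eq', Finset.mem_univ, if_true]

end Isolate

theorem exists_three_of_two_lt_encard {α : Type*} {S : Set α} (h : 2 < S.encard) (r : α)
    (hr : r ∈ S) :
    ∃ d ∈ S, d ≠ r ∧ ∃ e ∈ S, e ≠ r ∧ e ≠ d := by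
  have h1 : 1 < (S \ {r}).encard := by
    by_contra hn
    have h2 := Set.encard_sdiff_singleton_add_one hr
    have h3 : S.encard ≤ 2 := by
      rw [← h2]
      calc (S \ {r}).encard + 1 ≤ 1 + 1 := by gcongr; exact not_lt.1 hn
        _ = 2 := by norm_num
    exact absurd h (not_lt.2 h3)
  obtain ⟨d, e, hd, he, hne⟩ := Set.one_lt_encard_iff.1 h1
  exact ⟨d, hd.1, hd.2, e, he.1, he.2, hne.symm⟩

/-! ### Two branch vertices -/

section Transfer

variable {V : Type*} [Fintype V] {T : SimpleGraph V}

/-- Some connected graph on the same vertices has the same dissociation number and a smaller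
spectral radius. -/
def HasImprovement (T : SimpleGraph V) : Prop :=
  ∃ H : SimpleGraph V, H.Connected ∧ dissociationNumber H = dissociationNumber T ∧
    graphSpectralRadius H < graphSpectralRadius T

/-- Moving the last three vertices of a leg into an edge `uw` is an improvement if the ratios
`t₁`, `t₂`, `t₃` prescribed by the eigenvalue equation on the new vertices are positive and
`t₃` does not exceed the ratio `α` of the values at `w` and `u`. -/
theorem hasImprovement_of_pendantTriple (hT : T.IsTree) {z c₁ c₂ c₃ u w : V}
    (hc : PendantTriple T z c₁ c₂ c₃) (huw : T.Adj u w) (hu : u ≠ c₁ ∧ u ≠ c₂ ∧ u ≠ c₃)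
    (hw : w ≠ c₁ ∧ w ≠ c₂ ∧ w ≠ c₃) {x : V → ℝ} (hx : ∀ q, 0 < x q)
    (heig : ∀ q, adjSum T x q = graphSpectralRadius T * x q) {α t₁ t₂ t₃ : ℝ}
    (hα : x w = α * x u) (ht₁ : 0 < t₁) (ht₂ : 0 < t₂) (ht₃ : 0 < t₃)
    (h₁ : t₁ * (graphSpectralRadius T - α) = 1) (h₂ : t₂ * (graphSpectralRadius T - t₁) = 1)
    (h₃ : t₃ * (graphSpectralRadius T - t₂) = 1) (hle : t₃ ≤ α) : HasImprovement T := by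
  classical
  have hiso := hc.isolatedTriple
  have hz := hc.ne_end
  set G := isolate T {c₁, c₂, c₃} with hG
  have hTG : attachPath G z c₁ c₂ c₃ = T := hc.attachPath_eq
  have huwG : G.Adj u w := by simp [hG, isolate_adj, huw, hu, hw]
  have hconn : (insertPath G u w c₁ c₂ c₃).Connected :=
    insertPath_connected hiso huwG fun q r hq hr =>
      reachable_of_attachPath_connected hiso hz (hTG ▸ hT.connected) hq hr
  have hdiss : dissociationNumber (insertPath G u w c₁ c₂ c₃) = dissociationNumber T := by
    have h1 := dissociationNumber_insertPath hiso huwG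
    have h2 := dissociationNumber_attachPath hiso hz
    rw [hTG] at h2
    omega
  obtain ⟨A, hwA, huA, hA⟩ := exists_side_of_isAcyclic hT.isAcyclic huw
  have hsum : ∀ q, q ≠ c₁ ∧ q ≠ c₂ ∧ q ≠ c₃ → adjSum G x q
      = graphSpectralRadius T * x q - if q = z then x c₁ else 0 := fun q hq => by
    rw [← heig]; exact hc.adjSum_isolate x hq
  have hxu := hx u
  have hx1 := hx c₁
  refine ⟨_, hconn, hdiss, graphSpectralRadius_insertPath_lt hiso huwG hwA huA
    (fun q r h => hA q r h.1) hconn hx hα ht₁ ht₂ ht₃ h₁ h₂ h₃ ?_ ?_ ?_⟩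
  · intro q q1 q2 q3 _
    rw [hsum q ⟨q1, q2, q3⟩]
    split_ifs <;> linarith
  · rw [hsum u hu]
    split_ifs <;> nlinarith
  · by_cases hzu : u = z
    · left
      rw [hsum u hu, if_pos hzu]
      nlinarith
    · right
      refine ⟨z, hz.1, hz.2.1, hz.2.2, fun h => hzu h.symm, ?_⟩
      rw [hsum z hz, if_pos rfl]
      linarith

/-- The ratios needed for inserting three vertices at a minimum of the eigenvector. -/
theorem exists_ratios_le {ρ α : ℝ} (hρ : 2 ≤ ρ) (hα : 1 ≤ α) (h : 2 ≤ ρ * (ρ - α)) :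
    ∃ t₁ t₂ t₃ : ℝ, 0 < t₁ ∧ 0 < t₂ ∧ 0 < t₃ ∧ t₁ * (ρ - α) = 1 ∧ t₂ * (ρ - t₁) = 1 ∧
      t₃ * (ρ - t₂) = 1 ∧ t₃ ≤ α := by
  have p1 : 0 < ρ - α := by
    by_contra hn
    nlinarith
  have h1 : (ρ - α)⁻¹ ≤ ρ / 2 := by
    rw [inv_le_comm₀ p1 (by linarith), inv_div, div_le_iff₀ (by linarith)]
    linarith
  have p2 : 1 ≤ ρ - (ρ - α)⁻¹ := by linarith
  have h2 : (ρ - (ρ - α)⁻¹)⁻¹ ≤ 1 := inv_le_one_of_one_le₀ p2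
  have p3 : 1 ≤ ρ - (ρ - (ρ - α)⁻¹)⁻¹ := by linarith
  have h3 : (ρ - (ρ - (ρ - α)⁻¹)⁻¹)⁻¹ ≤ 1 := inv_le_one_of_one_le₀ p3
  exact ⟨_, _, _, inv_pos.2 p1, inv_pos.2 (by linarith), inv_pos.2 (by linarith),
    inv_mul_cancel₀ p1.ne', inv_mul_cancel₀ (by linarith), inv_mul_cancel₀ (by linarith),
    h3.trans hα⟩

/-- A nonempty set of vertices each of which has degree at least three and a neighbour in the set,
or two neighbours in the set. Such a set exists in a tree with two branch vertices, and the
eigenvector is minimized over it to find an edge suitable for an insertion. -/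
def IsBranchCore (T : SimpleGraph V) (P : Set V) : Prop :=
  P.Nonempty ∧ ∀ q ∈ P, ∃ r ∈ P, T.Adj q r ∧ ∃ d, d ≠ r ∧ T.Adj q d ∧
    (d ∈ P ∨ ∃ e, e ≠ r ∧ e ≠ d ∧ T.Adj q e)

/-- The weights `2` on the set, `1` on its further neighbours and `0` elsewhere form a
subsolution for the value `2`. -/
theorem two_le_of_isBranchCore {P : Set V} (hP : IsBranchCore T P) {x : V → ℝ} {ρ : ℝ}
    (hx : ∀ q, 0 < x q) (heig : ∀ q, adjSum T x q = ρ * x q) : 2 ≤ ρ := by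
  classical
  set y : V → ℝ := fun q => if q ∈ P then 2 else if ∃ r ∈ P, T.Adj q r then 1 else 0 with hy
  have hy0 : ∀ q, 0 ≤ y q := fun q => by simp only [hy]; split_ifs <;> norm_num
  have hyP : ∀ q ∈ P, y q = 2 := fun q hq => by simp [hy, hq]
  have hyN : ∀ q, ∀ r ∈ P, T.Adj r q → 1 ≤ y q := fun q r hr h => by
    simp only [hy]
    rw [if_pos (⟨r, hr, h.symm⟩ : ∃ r ∈ P, T.Adj q r)]
    split_ifs <;> norm_num
  obtain ⟨q₀, hq₀⟩ := hP.1
  refine le_of_pos_eigenvector hx heig hy0 ⟨q₀, by rw [hyP q₀ hq₀]; norm_num⟩ fun q => ?_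
  by_cases hq : q ∈ P
  · obtain ⟨r, hr, hqr, d, hdr, hqd, h⟩ := hP.2 q hq
    rw [hyP q hq]
    rcases h with hd | ⟨e, her, hed, hqe⟩
    · have := add_le_adjSum hy0 hqr hqd hdr.symm
      rw [hyP r hr, hyP d hd] at this
      linarith
    · have := add_add_le_adjSum hy0 hqr hqd hqe hdr.symm her.symm hed.symm
      rw [hyP r hr] at this
      linarith [hyN d q hq hqd, hyN e q hq hqe]
  · by_cases hN : ∃ r ∈ P, T.Adj q r
    · obtain ⟨r, hr, hqr⟩ := hN
      have h1 := le_adjSum hy0 hqr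
      rw [hyP r hr] at h1
      have h2 : y q = 1 := by
        simp only [hy, if_neg hq]
        exact if_pos ⟨r, hr, hqr⟩
      linarith
    · have h2 : y q = 0 := by simp only [hy, if_neg hq, if_neg hN]
      rw [h2, mul_zero]
      exact adjSum_nonneg hy0 q

theorem hasImprovement_of_isBranchCore (hT : T.IsTree) {P : Set V} (hP : IsBranchCore T P)
    {z c₁ c₂ c₃ : V} (hc : PendantTriple T z c₁ c₂ c₃) : HasImprovement T := by
  obtain ⟨x, hx, heig⟩ := exists_pos_eigenvector hT.connected
  have hρ := two_le_of_isBranchCore hP hx heig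
  set ρ := graphSpectralRadius T with hρdef
  have hc3 : c₃ ∉ P := by
    intro h
    obtain ⟨r, -, h1, d, hdr, h2, -⟩ := hP.2 _ h
    rw [hc.adj₃] at h1 h2
    exact hdr (h2.trans h1.symm)
  have hc2 : c₂ ∉ P := by
    intro h
    obtain ⟨r, hr, h1, d, hdr, h2, h3⟩ := hP.2 _ h
    rw [hc.adj₂] at h1 h2
    simp only [hc.adj₂] at h3
    grind
  have hc1 : c₁ ∉ P := by
    intro h
    obtain ⟨r, hr, h1, d, hdr, h2, h3⟩ := hP.2 _ h
    rw [hc.adj₁] at h1 h2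
    simp only [hc.adj₁] at h3
    grind
  have hPc : ∀ q ∈ P, q ≠ c₁ ∧ q ≠ c₂ ∧ q ≠ c₃ := fun q hq =>
    ⟨by rintro rfl; exact hc1 hq, by rintro rfl; exact hc2 hq, by rintro rfl; exact hc3 hq⟩
  obtain ⟨u, huP, humin⟩ := (Set.toFinite P).exists_minimalFor x P hP.1
  have hmin : ∀ q ∈ P, x u ≤ x q := fun q hq => by
    rcases le_total (x u) (x q) with h | h
    · exact h
    · exact humin hq h
  obtain ⟨w, hwP, huw, d, hdw, hud, h⟩ := hP.2 u huP
  have hxu := hx u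
  have hρ0 : 0 < ρ := by linarith
  have hα : x w = x w / x u * x u := by field_simp
  have hα1 : 1 ≤ x w / x u := by rw [one_le_div hxu]; exact hmin w hwP
  -- The neighbours of `u` other than `w` contribute at least `2 / ρ` times the value at `u`.
  have hrest : 2 * x u ≤ ρ * (ρ * x u - x w) := by
    have hx0 : ∀ q, 0 ≤ x q := fun q => (hx q).le
    have hd := le_adjSum hx0 hud.symm
    rw [heig] at hd
    rcases h with hdP | ⟨e, hew, hed, hue⟩
    · have := add_le_adjSum hx0 huw hud hdw.symm
      rw [heig] at this
      nlinarith [hmin d hdP]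
    · have h3 := add_add_le_adjSum hx0 huw hud hue hdw.symm hew.symm hed.symm
      rw [heig] at h3
      have he := le_adjSum hx0 hue.symm
      rw [heig] at he
      nlinarith
  have hα2 : 2 ≤ ρ * (ρ - x w / x u) := by
    have : ρ * (ρ - x w / x u) = ρ * (ρ * x u - x w) / x u := by field_simp
    rw [this, le_div_iff₀ hxu]
    exact hrest
  obtain ⟨t₁, t₂, t₃, p1, p2, p3, e1, e2, e3, hle⟩ := exists_ratios_le hρ hα1 hα2
  exact hasImprovement_of_pendantTriple hT hc huw (hPc u huP) (hPc w hwP) hx heig hα p1 p2 p3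
    e1 e2 e3 hle

end Transfer

theorem exists_isBranchCore {α : Type*} {T : SimpleGraph α} (hT : T.Connected) {v w : α}
    (hvw : v ≠ w) (hv : 2 < (T.neighborSet v).encard) (hw : 2 < (T.neighborSet w).encard) :
    ∃ P, IsBranchCore T P := by
  classical
  obtain ⟨p, hp⟩ := (hT.preconnected v w).exists_isPath
  have hlen : 0 < p.length := by
    rw [Nat.pos_iff_ne_zero]
    exact fun h => hvw (SimpleGraph.Walk.eq_of_length_eq_zero h)
  refine ⟨{q | q ∈ p.support}, ⟨v, p.start_mem_support⟩, fun q hq => ?_⟩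
  obtain ⟨i, rfl, hi⟩ := SimpleGraph.Walk.mem_support_iff_exists_getVert.1 hq
  have hmem : ∀ j, p.getVert j ∈ p.support := fun j => p.getVert_mem_support j
  rcases Nat.eq_zero_or_pos i with rfl | hi0
  · rw [SimpleGraph.Walk.getVert_zero]
    have h1 : T.Adj v (p.getVert 1) := by simpa using p.adj_getVert_succ hlen
    obtain ⟨d, hd, hdr, e, he, her, hed⟩ := exists_three_of_two_lt_encard hv _ h1
    exact ⟨_, hmem 1, h1, d, hdr, hd, Or.inr ⟨e, her, hed, he⟩⟩
  obtain ⟨j, rfl⟩ : ∃ j, i = j + 1 := ⟨i - 1, by omega⟩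
  have hprev : T.Adj (p.getVert (j + 1)) (p.getVert j) := (p.adj_getVert_succ (by omega)).symm
  rcases hi.lt_or_eq with hlt | heq
  · have hnext := p.adj_getVert_succ hlt
    refine ⟨_, hmem j, hprev, _, fun h => ?_, hnext, Or.inl (hmem _)⟩
    have := hp.getVert_injOn (show j + 1 + 1 ≤ p.length by omega) (show j ≤ p.length by omega) h
    omega
  · have hend : p.getVert (j + 1) = w := by rw [heq]; exact p.getVert_length
    rw [hend] at hprev ⊢
    obtain ⟨d, hd, hdr, e, he, her, hed⟩ := exists_three_of_two_lt_encard hw _ hprev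
    exact ⟨_, hmem j, hprev, d, hdr, hd, Or.inr ⟨e, her, hed, he⟩⟩

/-! ### Two leaves at a vertex -/

section TwoLeaves

variable {V : Type*} [Fintype V] {T : SimpleGraph V}

/-- If no dissociation set of `T` contains `v`, `a` and `b`, then exchanging `v` for `a` and `b`
turns dissociation sets of `T` into sets that are not smaller, and that are dissociation sets of
every graph in which `a` and `b` have no neighbours but `v` and each other. -/
theorem dissociationNumber_le_of_exchange {T H : SimpleGraph V} {v a b : V} (hab : a ≠ b)
    (hva : v ≠ a) (hvb : v ≠ b)
    (hT : ∀ S : Finset V, IsDissociationSet T S → v ∈ S → a ∈ S → b ∈ S → False)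
    (ha : ∀ r, H.Adj a r → r = v ∨ r = b) (hb : ∀ r, H.Adj b r → r = v ∨ r = a)
    (hTH : ∀ q r, q ≠ a → q ≠ b → r ≠ a → r ≠ b → H.Adj q r → T.Adj q r) :
    dissociationNumber T ≤ dissociationNumber H := by
  classical
  refine dissociationNumber_add_le (d := 0) (e := 0) fun S hS =>
    ⟨insert a (insert b (S.erase v)), ?_, ?_⟩
  · rw [isDissociationSet_iff] at hS ⊢
    have hmem : ∀ q, q ∈ insert a (insert b (S.erase v)) ↔ q = a ∨ q = b ∨ (q ≠ v ∧ q ∈ S) := by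
      simp
    intro q hq r hr s hs hqr hqs
    rw [hmem] at hq hr hs
    by_cases qa : q = a
    · subst qa
      have h1 := ha r hqr
      have h2 := ha s hqs
      grind
    by_cases qb : q = b
    · subst qb
      have h1 := hb r hqr
      have h2 := hb s hqs
      grind
    have hN : ∀ r, H.Adj q r → r ≠ a ∧ r ≠ b := by
      intro r h
      constructor
      · rintro rfl; have := ha q h.symm; grind
      · rintro rfl; have := hb q h.symm; grind
    obtain ⟨r1, r2⟩ := hN r hqr
    obtain ⟨s1, s2⟩ := hN s hqs
    refine hS q ?_ r ?_ s ?_ (hTH q r qa qb r1 r2 hqr) (hTH q s qa qb s1 s2 hqs)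
    · tauto
    · tauto
    · tauto
  · simp only [add_zero]
    by_cases hvS : v ∈ S
    · have h1 := Finset.card_erase_add_one hvS
      by_cases haS : a ∈ S
      · have hbS : b ∉ S.erase v := fun h => hT S hS hvS haS (Finset.mem_of_mem_erase h)
        have h2 := Finset.card_insert_of_notMem hbS
        have h3 := Finset.card_le_card (Finset.subset_insert a (insert b (S.erase v)))
        omega
      · have haS' : a ∉ insert b (S.erase v) := by simp [hab, haS]
        have h2 := Finset.card_insert_of_notMem haS'
        have h3 := Finset.card_le_card (Finset.subset_insert b (S.erase v))
        omega
    · rw [Finset.erase_eq_of_notMem hvS]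
      exact Finset.card_le_card ((Finset.subset_insert _ _).trans (Finset.subset_insert _ _))

/-- Moving a leaf `b` at `v` to another leaf `a` at `v` preserves the dissociation number: in both
graphs some maximum dissociation set contains `a` and `b` but not `v`. If `v` has a third
neighbour, then the spectral radius decreases. -/
theorem hasImprovement_of_two_leaves (hT : T.Connected) {v a b d : V} (hab : a ≠ b)
    (ha : ∀ r, T.Adj a r ↔ r = v) (hb : ∀ r, T.Adj b r ↔ r = v) (hd : T.Adj v d)
    (hda : d ≠ a) (hdb : d ≠ b) : HasImprovement T := by
  classical
  have hva : T.Adj v a := ((ha v).2 rfl).symm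
  have hvb : T.Adj v b := ((hb v).2 rfl).symm
  have nva := hva.ne
  have nvb := hvb.ne
  obtain ⟨H, hH⟩ : ∃ H, H = isolate T {b} ⊔ SimpleGraph.edge a b := ⟨_, rfl⟩
  have hadj : ∀ q r, H.Adj q r ↔ (T.Adj q r ∧ q ≠ b ∧ r ≠ b) ∨ (q = a ∧ r = b) ∨
      (q = b ∧ r = a) := by
    intro q r
    simp only [hH, SimpleGraph.sup_adj, isolate_adj, SimpleGraph.edge_adj, Set.mem_singleton_iff]
    grind
  have hab' : H.Adj a b := (hadj _ _).2 (by simp)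
  have hva' : H.Adj v a := (hadj _ _).2 (Or.inl ⟨hva, nvb, hab⟩)
  have hconn : H.Connected := by
    have hstep : ∀ q r, T.Adj q r → H.Reachable q r := by
      intro q r h
      by_cases hq : q = b
      · subst hq
        rw [(hb r).1 h]
        exact (hva'.reachable.trans hab'.reachable).symm
      by_cases hr : r = b
      · subst hr
        rw [(hb q).1 h.symm]
        exact hva'.reachable.trans hab'.reachable
      · exact ((hadj _ _).2 (Or.inl ⟨h, hq, hr⟩)).reachable
    have : Nonempty V := ⟨v⟩
    exact ⟨fun q r => SimpleGraph.Reachable.of_forall_adj (f := id) hstep (hT.preconnected q r)⟩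
  have ha' : ∀ r, H.Adj a r ↔ r = v ∨ r = b := by
    intro r; rw [hadj, ha]; grind
  have hb' : ∀ r, H.Adj b r ↔ r = a := by
    intro r; rw [hadj, hb]; grind
  have hdiss : dissociationNumber H = dissociationNumber T := by
    refine le_antisymm
      (dissociationNumber_le_of_exchange (v := v) (a := a) (b := b) hab nva nvb ?_ ?_ ?_ ?_)
      (dissociationNumber_le_of_exchange (v := v) (a := a) (b := b) hab nva nvb ?_ ?_ ?_ ?_)
    · exact fun S hS hv ha hb =>
        nvb (isDissociationSet_iff.1 hS a ha v hv b hb hva'.symm hab')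
    · exact fun r h => Or.inl ((ha r).1 h)
    · exact fun r h => Or.inl ((hb r).1 h)
    · exact fun q r _ hq _ hr h => (hadj q r).2 (Or.inl ⟨h, hq, hr⟩)
    · exact fun S hS hv ha hb => hab (isDissociationSet_iff.1 hS v hv a ha b hb hva hvb)
    · exact fun r h => (ha' r).1 h
    · exact fun r h => Or.inr ((hb' r).1 h)
    · intro q r hq hq' _ _ h
      rw [hadj] at h
      rcases h with h | h | h
      exacts [h.1, absurd h.1 hq, absurd h.1 hq']
  obtain ⟨x, hx, heig⟩ := exists_pos_eigenvector hT
  set ρ := graphSpectralRadius T with hρ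
  have hx0 : ∀ q, 0 ≤ x q := fun q => (hx q).le
  have exa : ρ * x a = x v := by rw [← heig, adjSum_of_adj_iff_eq ha]
  have exb : ρ * x b = x v := by rw [← heig, adjSum_of_adj_iff_eq hb]
  have exd : x v ≤ ρ * x d := by rw [← heig]; exact le_adjSum hx0 hd.symm
  have exv : x a + x b + x d ≤ ρ * x v := by
    rw [← heig]; exact add_add_le_adjSum hx0 hva hvb hd hab hda.symm hdb.symm
  have xv := hx v
  have xa := hx a
  have hρ0 : 0 < ρ := by
    by_contra hn
    nlinarith
  have hρ3 : 3 ≤ ρ * ρ := by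
    have : 3 * x v ≤ ρ * ρ * x v := by nlinarith
    exact le_of_mul_le_mul_right this xv
  -- The values on the new leg `a`, `b` of length one are forced by the eigenvalue equation.
  set κ := x v / (ρ * ρ - 1) with hκ
  have hκpos : 0 < κ := div_pos xv (by linarith)
  have hκ' : κ * (ρ * ρ - 1) = x v := div_mul_cancel₀ _ (by linarith)
  set y : V → ℝ := fun q => if q = a then ρ * κ else if q = b then κ else x q with hy
  have ya : y a = ρ * κ := by simp [hy]
  have yb : y b = κ := by simp [hy, hab.symm]
  have yq : ∀ q, q ≠ a → q ≠ b → y q = x q := fun q h h' => by simp [hy, h, h']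
  have sv : adjSum H y v = ρ * x v - x a - x b + ρ * κ := by
    have : ∀ r, (if H.Adj v r then y r else 0) = (if T.Adj v r then x r else 0)
        + (if r = a then ρ * κ - x a else 0) - (if r = b then x b else 0) := by
      intro r
      by_cases r1 : r = a
      · subst r1; simp [hva', hva, ya, hab]
      by_cases r2 : r = b
      · subst r2
        have : ¬ H.Adj v r := by rw [hadj]; grind
        simp [this, hvb, hab.symm]
      have : H.Adj v r ↔ T.Adj v r := by rw [hadj]; grind
      simp [this, r1, r2, yq r r1 r2]
    rw [← heig]
    simp only [adjSum, this, Finset.sum_add_distrib, Finset.sum_sub_distrib, Finset.sum_ite_eq',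
      Finset.mem_univ, if_true]
    ring
  have hlt : adjSum H y v < ρ * y v := by
    rw [sv, yq v nva nvb]
    have h1 : ρ * (ρ * κ) < ρ * (x a + x b) := by nlinarith
    have := lt_of_mul_lt_mul_left h1 hρ0.le
    linarith
  refine ⟨H, hconn, hdiss, graphSpectralRadius_lt hconn (y := y) (fun q => ?_) (fun q => ?_)
    ⟨v, hlt⟩⟩
  · by_cases q1 : q = a
    · rw [q1, adjSum_of_adj_iff_or ha' nvb, ya, yb, yq v nva nvb]
      nlinarith
    by_cases q2 : q = b
    · rw [q2, adjSum_of_adj_iff_eq hb', ya, yb]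
    by_cases q3 : q = v
    · rw [q3]; exact hlt.le
    rw [yq q q1 q2, ← heig]
    refine le_of_eq (Finset.sum_congr rfl fun r _ => ?_)
    by_cases r1 : r = a
    · subst r1
      have h1 : ¬ H.Adj q r := by rw [H.adj_comm, ha']; grind
      have h2 : ¬ T.Adj q r := by rw [T.adj_comm, ha]; grind
      simp [h1, h2]
    by_cases r2 : r = b
    · subst r2
      have h1 : ¬ H.Adj q r := by rw [H.adj_comm, hb']; grind
      have h2 : ¬ T.Adj q r := by rw [T.adj_comm, hb]; grind
      simp [h1, h2]
    have : H.Adj q r ↔ T.Adj q r := by rw [hadj]; grind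
    simp [this, yq r r1 r2]
  · simp only [hy]
    split_ifs
    exacts [by positivity, hκpos, hx q]

end TwoLeaves

/-! ### Replacing a path by an edge -/

section Bypass

variable {V : Type*} {T : SimpleGraph V}

/-- Three consecutive vertices of degree two on a path `z c₁ c₂ c₃ z'` whose ends are distinct
and not adjacent. -/
structure ChainTriple (T : SimpleGraph V) (z c₁ c₂ c₃ z' : V) : Prop where
  ne : c₁ ≠ c₃
  ne_left : z ≠ c₁ ∧ z ≠ c₂ ∧ z ≠ c₃
  ne_right : z' ≠ c₁ ∧ z' ≠ c₂ ∧ z' ≠ c₃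
  ends_ne : z ≠ z'
  not_adj : ¬ T.Adj z z'
  adj₁ : ∀ r, T.Adj c₁ r ↔ r = z ∨ r = c₂
  adj₂ : ∀ r, T.Adj c₂ r ↔ r = c₁ ∨ r = c₃
  adj₃ : ∀ r, T.Adj c₃ r ↔ r = c₂ ∨ r = z'

/-- The graph in which the path `z c₁ c₂ c₃ z'` is replaced by the edge `z z'`. -/
def bypass (T : SimpleGraph V) (z c₁ c₂ c₃ z' : V) : SimpleGraph V :=
  isolate T {c₁, c₂, c₃} ⊔ SimpleGraph.edge z z'

namespace ChainTriple

variable {z c₁ c₂ c₃ z' : V}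

theorem bypass_adj (h : ChainTriple T z c₁ c₂ c₃ z') (q r : V) :
    (bypass T z c₁ c₂ c₃ z').Adj q r ↔ (T.Adj q r ∧ (q ≠ c₁ ∧ q ≠ c₂ ∧ q ≠ c₃) ∧
      (r ≠ c₁ ∧ r ≠ c₂ ∧ r ≠ c₃)) ∨ (q = z ∧ r = z') ∨ (q = z' ∧ r = z) := by
  have := h.ends_ne
  simp only [bypass, SimpleGraph.sup_adj, isolate_adj, SimpleGraph.edge_adj,
    Set.mem_insert_iff, Set.mem_singleton_iff, not_or]
  grind

theorem isolatedTriple (h : ChainTriple T z c₁ c₂ c₃ z') :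
    IsolatedTriple (bypass T z c₁ c₂ c₃ z') c₁ c₂ c₃ := by
  have hl := h.ne_left
  have hr := h.ne_right
  refine ⟨((h.adj₁ c₂).2 (Or.inr rfl)).ne, h.ne, ((h.adj₂ c₃).2 (Or.inr rfl)).ne, ?_, ?_, ?_⟩
  all_goals
    intro r hadj
    rw [h.bypass_adj] at hadj
    grind

theorem insertPath_eq (h : ChainTriple T z c₁ c₂ c₃ z') :
    insertPath (bypass T z c₁ c₂ c₃ z') z z' c₁ c₂ c₃ = T := by
  have hiso := h.isolatedTriple
  have hadj := h.bypass_adj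
  have hzz : (bypass T z c₁ c₂ c₃ z').Adj z z' := (hadj _ _).2 (by simp)
  obtain ⟨hne, hl, hr, he, hn, h1, h2, h3⟩ := h
  have n12 := hiso.ne₁₂
  have n23 := hiso.ne₂₃
  ext q r
  rw [insertPath_adj hiso hzz, hadj]
  clear hadj hiso hzz
  have hs : T.Adj q r ↔ T.Adj r q := T.adj_comm q r
  by_cases q1 : q = c₁
  · subst q1; rw [h1]; grind
  by_cases q2 : q = c₂
  · subst q2; rw [h2]; grind
  by_cases q3 : q = c₃
  · subst q3; rw [h3]; grind
  by_cases r1 : r = c₁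
  · subst r1; rw [hs, h1]; grind
  by_cases r2 : r = c₂
  · subst r2; rw [hs, h2]; grind
  by_cases r3 : r = c₃
  · subst r3; rw [hs, h3]; grind
  have : ¬ (q = z ∧ r = z' ∧ T.Adj q r) := by rintro ⟨rfl, rfl, h⟩; exact hn h
  have : ¬ (q = z' ∧ r = z ∧ T.Adj q r) := by rintro ⟨rfl, rfl, h⟩; exact hn h.symm
  grind

/-- If the side `D` of `z'` is scaled so that `z` takes the place of `c₃`, then replacing the path
by an edge changes the sums over neighbours only at `z` and on the path. -/
theorem adjSum_bypass [Fintype V] (h : ChainTriple T z c₁ c₂ c₃ z') {D : Set V} (hzD : z ∉ D)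
    (hD' : z' ∈ D) (hD : ∀ q r, T.Adj q r → q ∈ D → r ∉ D → q = z' ∧ r = c₃) {x κ : V → ℝ}
    {μ : ℝ} (hμ : μ * x c₃ = x z) (hκ : ∀ q ∈ D, κ q = μ) (hκ' : ∀ q, q ∉ D → κ q = 1) :
    adjSum (bypass T z c₁ c₂ c₃ z') (fun q => κ q * x q) z
        = adjSum T x z - x c₁ + μ * x z' ∧
      ∀ q, q ≠ c₁ → q ≠ c₂ → q ≠ c₃ → q ≠ z →
        adjSum (bypass T z c₁ c₂ c₃ z') (fun q => κ q * x q) q = κ q * adjSum T x q := by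
  classical
  have hadj := h.bypass_adj
  generalize bypass T z c₁ c₂ c₃ z' = G at hadj ⊢
  obtain ⟨hne, hl, hr, he, hn, h1, h2, h3⟩ := h
  have hκadj : ∀ q r, T.Adj q r → q ≠ c₃ → r ≠ c₃ → κ r = κ q := by
    intro q r h hq hr
    by_cases qD : q ∈ D <;> by_cases rD : r ∈ D
    · rw [hκ q qD, hκ r rD]
    · exact absurd (hD q r h qD rD).2 hr
    · exact absurd (hD r q h.symm rD qD).2 hq
    · rw [hκ' q qD, hκ' r rD]
  have hq1 : ∀ {q}, T.Adj q c₁ → q = z ∨ q = c₂ := fun h => (h1 _).1 h.symm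
  have hq2 : ∀ {q}, T.Adj q c₂ → q = c₁ ∨ q = c₃ := fun h => (h2 _).1 h.symm
  have hq3 : ∀ {q}, T.Adj q c₃ → q = c₂ ∨ q = z' := fun h => (h3 _).1 h.symm
  constructor
  · have : ∀ r, (if G.Adj z r then κ r * x r else 0) = (if T.Adj z r then x r else 0)
        - (if r = c₁ then x c₁ else 0) + (if r = z' then μ * x z' else 0) := by
      intro r
      by_cases r1 : r = c₁
      · subst r1
        have hG : ¬ G.Adj z r := by rw [hadj]; grind
        have hT : T.Adj z r := ((h1 z).2 (Or.inl rfl)).symm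
        simp [hG, hT, hr.1.symm]
      by_cases r4 : r = z'
      · subst r4
        have hG : G.Adj z r := (hadj _ _).2 (by simp)
        simp [hG, hn, r1, hκ r hD']
      have hN : T.Adj z r → r ≠ c₂ ∧ r ≠ c₃ := fun h =>
        ⟨by rintro rfl; have := hq2 h; tauto, by rintro rfl; have := hq3 h; tauto⟩
      have hiff : G.Adj z r ↔ T.Adj z r := by rw [hadj]; tauto
      by_cases hr : T.Adj z r
      · have := hκadj z r hr hl.2.2 (hN hr).2
        simp [hiff, hr, r1, r4, this, hκ' z hzD]
      · simp [hiff, hr, r1, r4]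
    simp only [adjSum, this, Finset.sum_add_distrib, Finset.sum_sub_distrib,
      Finset.sum_ite_eq', Finset.mem_univ, if_true]
  · intro q q1 q2 q3 qz
    have hqc1 : ¬ T.Adj q c₁ := fun h => by have := hq1 h; tauto
    have hqc2 : ¬ T.Adj q c₂ := fun h => by have := hq2 h; tauto
    by_cases q4 : q = z'
    · subst q4
      have : ∀ r, (if G.Adj q r then κ r * x r else 0)
          = κ q * (if T.Adj q r then x r else 0)
            - (if r = c₃ then x z else 0) + (if r = z then x z else 0) := by
        intro r
        by_cases r3 : r = c₃
        · subst r3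
          have hG : ¬ G.Adj q r := by rw [hadj]; grind
          have hT : T.Adj q r := ((h3 q).2 (Or.inr rfl)).symm
          simp [hG, hT, hl.2.2.symm, hκ q hD', hμ]
        by_cases rz : r = z
        · subst rz
          have hG : G.Adj q r := (hadj _ _).2 (by simp)
          have hT : ¬ T.Adj q r := fun h => hn h.symm
          simp [hG, hT, r3, hκ' r hzD]
        have hN : T.Adj q r → r ≠ c₁ ∧ r ≠ c₂ := fun h =>
          ⟨by rintro rfl; exact hqc1 h, by rintro rfl; exact hqc2 h⟩
        have hiff : G.Adj q r ↔ T.Adj q r := by rw [hadj]; tauto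
        by_cases hr : T.Adj q r
        · simp [hiff, hr, r3, rz, hκadj q r hr q3 r3]
        · simp [hiff, hr, r3, rz]
      simp only [adjSum, this, Finset.sum_add_distrib, Finset.sum_sub_distrib,
        Finset.sum_ite_eq', Finset.mem_univ, if_true, ← Finset.mul_sum]
      ring
    · have hqc3 : ¬ T.Adj q c₃ := fun h => by have := hq3 h; tauto
      rw [adjSum, adjSum, Finset.mul_sum]
      refine Finset.sum_congr rfl fun r _ => ?_
      have hN : T.Adj q r → r ≠ c₁ ∧ r ≠ c₂ ∧ r ≠ c₃ := fun h =>
        ⟨by rintro rfl; exact hqc1 h, by rintro rfl; exact hqc2 h,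
          by rintro rfl; exact hqc3 h⟩
      have hiff : G.Adj q r ↔ T.Adj q r := by rw [hadj]; tauto
      by_cases hr : T.Adj q r
      · simp [hiff, hr, hκadj q r hr q3 (hN hr).2.2]
      · simp [hiff, hr]

end ChainTriple

end Bypass

/-! ### Two long legs at a vertex -/

section TwoLegs

variable {V : Type*} [Fintype V] {T : SimpleGraph V}

/-- The map `t ↦ 1 / (ρ - t)` sends the ratio of consecutive values on a leg to the preceding
ratio, and it contracts distances below `1`. The hypotheses on `β` say that `β` lies below the
smaller fixed point, so that the iterates `s₁`, `s₂`, `s₃` of `β` increase and `β < α`. Hence the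
third iterate `t₃` of `α` exceeds `α` by less than `s₃` exceeds `β`. -/
theorem add_iterate_lt {ρ α β s₁ s₂ s₃ t₁ t₂ t₃ : ℝ} (hρ : 2 ≤ ρ) (hβ1 : β < 1)
    (hβ : 0 < β ^ 2 - ρ * β + 1) (s1 : s₁ * (ρ - β) = 1) (s2 : s₂ * (ρ - s₁) = 1)
    (s3 : s₃ * (ρ - s₂) = 1) (t1 : t₁ * (ρ - α) = 1) (t2 : t₂ * (ρ - t₁) = 1)
    (t3 : t₃ * (ρ - t₂) = 1) (hα : s₃ ≤ α) (hα1 : α < 1) : β + t₃ < α + s₃ := by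
  have aux : ∀ {s t : ℝ}, t < 1 → s * (ρ - t) = 1 → 0 < s ∧ s < 1 := by
    intro s t ht hs
    have hp : 0 < s := by
      by_contra hn
      nlinarith
    exact ⟨hp, by nlinarith⟩
  obtain ⟨s1p, s1l⟩ := aux hβ1 s1
  obtain ⟨s2p, s2l⟩ := aux s1l s2
  obtain ⟨s3p, s3l⟩ := aux s2l s3
  obtain ⟨t1p, t1l⟩ := aux hα1 t1
  obtain ⟨t2p, t2l⟩ := aux t1l t2
  obtain ⟨t3p, t3l⟩ := aux t2l t3
  have step : ∀ {p q a b : ℝ}, p * (ρ - a) = 1 → q * (ρ - b) = 1 → p - q = p * q * (a - b) := by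
    intro p q a b hp hq
    linear_combination q * hp - p * hq
  have d1 : 0 < s₁ - β := by
    have : s₁ - β = s₁ * (β ^ 2 - ρ * β + 1) := by linear_combination β * s1
    rw [this]; positivity
  have d2 : 0 < s₂ - s₁ := by rw [step s2 s1]; positivity
  have d3 : 0 < s₃ - s₂ := by rw [step s3 s2]; positivity
  have hαβ : 0 < α - β := by linarith
  have e1 := step t1 s1
  have e2 := step t2 s2
  have e3 := step t3 s3
  have prod : ∀ {p q : ℝ}, 0 < p → p < 1 → q < 1 → p * q < 1 := fun h h' h'' =>
    mul_lt_one_of_nonneg_of_lt_one_left h.le h' h''.le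
  have c1 : t₁ - s₁ < α - β := by
    rw [e1]; exact mul_lt_of_lt_one_left hαβ (prod t1p t1l s1l)
  have p1 : 0 < t₁ - s₁ := by rw [e1]; positivity
  have c2 : t₂ - s₂ < t₁ - s₁ := by
    rw [e2]; exact mul_lt_of_lt_one_left p1 (prod t2p t2l s2l)
  have p2 : 0 < t₂ - s₂ := by rw [e2]; positivity
  have c3 : t₃ - s₃ < t₂ - s₂ := by
    rw [e3]; exact mul_lt_of_lt_one_left p2 (prod t3p t3l s3l)
  linarith

/-- A second leg with at least three vertices, compared with the leg through `a` at the level of a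
graph `G` in which the vertices `b₁`, `b₂`, `b₃` are isolated and the rest `β` of the second leg,
measured by its contribution to the sum at `v`, hangs directly at `v`. -/
theorem hasImprovement_of_rerooted_leg {G : SimpleGraph V} {v a b₁ b₂ b₃ : V}
    (hc : IsolatedTriple G b₁ b₂ b₃) (hva : G.Adj v a)
    (hreach : ∀ q r, (q ≠ b₁ ∧ q ≠ b₂ ∧ q ≠ b₃) → (r ≠ b₁ ∧ r ≠ b₂ ∧ r ≠ b₃) → G.Reachable q r)
    (hdiss : dissociationNumber T + 1 = dissociationNumber G) {A : Set V} (haA : a ∈ A)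
    (hvA : v ∉ A) (hA : ∀ q r, G.Adj q r → q ∈ A → r ∉ A → q = a ∧ r = v)
    {x y : V → ℝ} {β : ℝ} (hx : ∀ q, 0 < x q) (hy : ∀ q, 0 < y q)
    (hρ : 2 ≤ graphSpectralRadius T) (hyv : y v = x v) (hya : y a = x a)
    (hab : x b₁ ≤ x a) (hav : x a < x v) (hβ1 : β < 1)
    (hβ : 0 < β ^ 2 - graphSpectralRadius T * β + 1)
    (e₁ : x v + x b₂ = graphSpectralRadius T * x b₁)
    (e₂ : x b₁ + x b₃ = graphSpectralRadius T * x b₂)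
    (e₃ : x b₂ + β * x b₃ = graphSpectralRadius T * x b₃)
    (hv : adjSum G y v = graphSpectralRadius T * x v - x b₁ + β * x v)
    (hq : ∀ q, q ≠ b₁ → q ≠ b₂ → q ≠ b₃ → q ≠ v →
      adjSum G y q = graphSpectralRadius T * y q) : HasImprovement T := by
  set ρ := graphSpectralRadius T with hρdef
  have xv := hx v
  have xb1 := hx b₁
  have xb2 := hx b₂
  have hα1 : x a / x v < 1 := (div_lt_one xv).2 hav
  have aux : ∀ {t : ℝ}, t < 1 → 0 < (ρ - t)⁻¹ ∧ (ρ - t)⁻¹ < 1 ∧ (ρ - t)⁻¹ * (ρ - t) = 1 := by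
    intro t ht
    have : 1 < ρ - t := by linarith
    exact ⟨by positivity, inv_lt_one_of_one_lt₀ this, inv_mul_cancel₀ (by positivity)⟩
  obtain ⟨p1, l1, t1⟩ := aux hα1
  obtain ⟨p2, l2, t2⟩ := aux l1
  obtain ⟨p3, l3, t3⟩ := aux l2
  have s1 : x b₃ / x b₂ * (ρ - β) = 1 := by
    rw [div_mul_eq_mul_div, div_eq_one_iff_eq xb2.ne']; linarith
  have s2 : x b₂ / x b₁ * (ρ - x b₃ / x b₂) = 1 := by
    field_simp; linarith
  have s3 : x b₁ / x v * (ρ - x b₂ / x b₁) = 1 := by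
    field_simp; linarith
  have key := add_iterate_lt hρ hβ1 hβ s1 s2 s3 t1 t2 t3 (by gcongr) hα1
  have hstrict : adjSum G y v + ((ρ - (ρ - (ρ - x a / x v)⁻¹)⁻¹)⁻¹ - x a / x v) * y v
      < ρ * y v := by
    rw [hv, hyv]
    have h1 := mul_lt_mul_of_pos_right key xv
    have h2 : x b₁ / x v * x v = x b₁ := div_mul_cancel₀ _ xv.ne'
    nlinarith
  have hconn := insertPath_connected hc hva hreach
  refine ⟨insertPath G v a b₁ b₂ b₃, hconn, ?_, ?_⟩
  · have := dissociationNumber_insertPath hc hva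
    omega
  · exact graphSpectralRadius_insertPath_lt hc hva haA hvA hA hconn hy
      (by rw [hyv, hya, div_mul_cancel₀ _ xv.ne']) p1 p2 p3 t1 t2 t3
      (fun q q1 q2 q3 q4 => (hq q q1 q2 q3 q4).le) hstrict.le (Or.inl hstrict)

/-- A vertex with two legs of at least three vertices and a third neighbour forces `ρ ≥ 2`: the
weights `4` at `v`, `3, 2, 1` along the legs and `2` at the third neighbour show this. -/
theorem two_le_of_two_legs {v a b d : V} {m m' : ℕ} (ha : Leg T v a m) (hb : Leg T v b m')
    (hm : 2 ≤ m) (hm' : 2 ≤ m') (hab : a ≠ b) (hd : T.Adj v d) (hda : d ≠ a) (hdb : d ≠ b)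
    {x : V → ℝ} {ρ : ℝ} (hx : ∀ q, 0 < x q) (heig : ∀ q, adjSum T x q = ρ * x q) : 2 ≤ ρ := by
  have hx0 : ∀ q, 0 ≤ x q := fun q => (hx q).le
  have aux : ∀ {a : V} {m : ℕ}, Leg T v a m → 2 ≤ m → ∃ a₂ a₃, x v + x a₂ = ρ * x a ∧
      x a + x a₃ = ρ * x a₂ ∧ x a₂ ≤ ρ * x a₃ := by
    intro a m h hm
    rcases h with _ | @⟨_, _, a₂, _, hne, h1, hleg⟩
    · omega
    rcases hleg with _ | @⟨_, _, a₃, _, hne', h2, hleg'⟩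
    · omega
    refine ⟨a₂, a₃, ?_, ?_, ?_⟩
    · rw [← heig, adjSum_of_adj_iff_or h1 hne.symm]
    · rw [← heig, adjSum_of_adj_iff_or h2 hne'.symm]
    · rw [← heig]; exact le_adjSum hx0 hleg'.adj.symm
  obtain ⟨a₂, a₃, i1, i2, i3⟩ := aux ha hm
  obtain ⟨b₂, b₃, j1, j2, j3⟩ := aux hb hm'
  have hv := add_add_le_adjSum hx0 ha.adj hb.adj hd hab hda.symm hdb.symm
  have hd' := le_adjSum hx0 hd.symm
  rw [heig] at hv hd'
  have hW : 0 < 4 * x v + 3 * x a + 2 * x a₂ + x a₃ + 3 * x b + 2 * x b₂ + x b₃ + 2 * x d := by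
    have := hx v; have := hx a; have := hx a₂; have := hx a₃; have := hx b; have := hx b₂
    have := hx b₃; have := hx d
    positivity
  exact le_of_mul_le_mul_right (by linarith) hW

theorem hasImprovement_of_two_legs_of_le (hT : T.IsTree) {v a b d : V} {m m' : ℕ}
    (ha : Leg T v a m) (hb : Leg T v b m') (hm : 2 ≤ m) (hm' : 2 ≤ m') (hab : a ≠ b)
    (hd : T.Adj v d) (hda : d ≠ a) (hdb : d ≠ b) {x : V → ℝ} (hx : ∀ q, 0 < x q)
    (heig : ∀ q, adjSum T x q = graphSpectralRadius T * x q) (hle : x b ≤ x a) :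
    HasImprovement T := by
  classical
  have hρ := two_le_of_two_legs ha hb hm hm' hab hd hda hdb hx heig
  have hav := (ha.eigenvector_lt hx heig hρ).1
  set ρ := graphSpectralRadius T with hρdef
  have hva := ha.adj
  have hvb := hb.adj
  obtain ⟨A, haA, hvA, hA⟩ := exists_side_of_isAcyclic hT.isAcyclic hva
  rcases hb with _ | @⟨_, _, b₂, _, hne, h1, hleg⟩
  · omega
  rcases hleg with _ | @⟨_, _, b₃, _, hne', h2, hleg'⟩
  · omega
  have e1 : x v + x b₂ = ρ * x b := by rw [← heig, adjSum_of_adj_iff_or h1 hne.symm]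
  have e2 : x b + x b₃ = ρ * x b₂ := by rw [← heig, adjSum_of_adj_iff_or h2 hne'.symm]
  have nbv : v ≠ b := ((h1 v).2 (Or.inl rfl)).ne'
  have n12 : b ≠ b₂ := ((h1 b₂).2 (Or.inr rfl)).ne
  have n23 : b₂ ≠ b₃ := ((h2 b₃).2 (Or.inr rfl)).ne
  -- The side `B` of `b` in the tree without the edge `vb` contains the leg, and `b` is the only
  -- vertex of `B` adjacent to `v`.
  obtain ⟨B, hbB, hvB, hB⟩ := exists_side_of_isAcyclic hT.isAcyclic hvb
  have hBv : ∀ q ∈ B, T.Adj v q → q = b := fun q hq h => (hB q v h.symm hq hvB).1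
  have h2B : b₂ ∈ B := by
    by_contra h
    exact hne (hB b b₂ ((h1 b₂).2 (Or.inr rfl)) hbB h).2
  have h3B : b₃ ∈ B := by
    by_contra h
    exact n12.symm (hB b₂ b₃ ((h2 b₃).2 (Or.inr rfl)) h2B h).1
  have hab2 : a ≠ b₂ := by
    rintro rfl
    exact n12.symm (hBv _ h2B hva)
  have hab3 : a ≠ b₃ := by
    rintro rfl
    exact hne' (hBv _ h3B hva)
  have hvC : v ≠ b ∧ v ≠ b₂ ∧ v ≠ b₃ :=
    ⟨nbv, hne.symm, by rintro rfl; exact hvB h3B⟩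
  cases hleg' with
  | leaf h3 =>
    have hpt : PendantTriple T v b b₂ b₃ := ⟨hne'.symm, hne.symm, h1, h2, h3⟩
    have hiso := hpt.isolatedTriple
    have hvend := hpt.ne_end
    refine hasImprovement_of_rerooted_leg (y := x) (β := 0) hiso
      (isolate_adj.2 ⟨hva, by simp [hvend], by simp [hab, hab2, hab3]⟩)
      (fun q r => reachable_of_attachPath_connected hiso hvend
        (by rw [hpt.attachPath_eq]; exact hT.connected))
      ?_ haA hvA (fun q r h => hA q r h.1) hx hx hρ rfl rfl hle hav one_pos
      (by norm_num) e1 e2 ?_ ?_ ?_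
    · rw [← dissociationNumber_attachPath hiso hvend, hpt.attachPath_eq]
    · rw [← heig, adjSum_of_adj_iff_eq h3]; ring
    · rw [hpt.adjSum_isolate x hvend, if_pos rfl, heig]; ring
    · intro q q1 q2 q3 qv
      rw [hpt.adjSum_isolate x ⟨q1, q2, q3⟩, if_neg qv, heig]; ring
  | @cons _ _ b₄ _ hne'' h3 hleg'' =>
    have e3 : x b₂ + x b₄ = ρ * x b₃ := by rw [← heig, adjSum_of_adj_iff_or h3 hne''.symm]
    obtain ⟨hlt43, hQ⟩ := hleg''.eigenvector_lt hx heig hρ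
    have n34 : b₃ ≠ b₄ := hleg''.adj.ne
    have h4B : b₄ ∈ B := by
      by_contra h
      exact hne' (hB b₃ b₄ hleg''.adj h3B h).1
    have n4b : b₄ ≠ b := by
      rintro rfl
      rcases (h1 b₃).1 hleg''.adj.symm with h | h
      exacts [hvC.2.2 h.symm, n23.symm h]
    have hv4 : v ≠ b₄ := by rintro rfl; exact hvB h4B
    have hnv4 : ¬ T.Adj v b₄ := fun h => n4b (hBv _ h4B h)
    have h4C : b₄ ≠ b ∧ b₄ ≠ b₂ ∧ b₄ ≠ b₃ := ⟨n4b, hne'', n34.symm⟩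
    obtain ⟨D, h4D, h3D, hD⟩ := exists_side_of_isAcyclic hT.isAcyclic hleg''.adj
    have hchain : ChainTriple T v b b₂ b₃ b₄ :=
      ⟨hne'.symm, hvC, h4C, hv4, hnv4, h1, h2, h3⟩
    have hiso := hchain.isolatedTriple
    have hTG := hchain.insertPath_eq
    have hGadj := hchain.bypass_adj
    have hv4G : (bypass T v b b₂ b₃ b₄).Adj v b₄ := (hGadj _ _).2 (by simp)
    have hvaG : (bypass T v b b₂ b₃ b₄).Adj v a :=
      (hGadj _ _).2 (Or.inl ⟨hva, hvC, hab, hab2, hab3⟩)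
    have a12 : T.Adj b b₂ := (h1 b₂).2 (Or.inr rfl)
    have a23 : T.Adj b₂ b₃ := (h2 b₃).2 (Or.inr rfl)
    have bA : b ∉ A := fun h => hab (hA b v hvb.symm h hvA).1.symm
    have b2A : b₂ ∉ A := fun h => hab2 (hA b₂ b a12.symm h bA).1.symm
    have b3A : b₃ ∉ A := fun h => hab3 (hA b₃ b₂ a23.symm h b2A).1.symm
    have b4A : b₄ ∉ A := fun h => hvC.2.2 (hA b₄ b₃ hleg''.adj.symm h b3A).2.symm
    have b2D : b₂ ∉ D := fun h => h4C.2.1 (hD b₂ b₃ a23 h h3D).1.symm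
    have bD : b ∉ D := fun h => n4b (hD b b₂ a12 h b2D).1.symm
    have vD : v ∉ D := fun h => hv4 (hD v b hvb h bD).1
    have aD : a ∉ D := fun h => hnv4 ((hD a v hva.symm h vD).1 ▸ hva)
    have xv := hx v
    have xb3 := hx b₃
    have xb4 := hx b₄
    -- The part of the leg beyond `b₃` is scaled so that `v` can take the place of `b₃`.
    obtain ⟨μ, hμ⟩ : ∃ μ, μ = x v / x b₃ := ⟨_, rfl⟩
    have hμpos : 0 < μ := hμ ▸ div_pos xv xb3
    have hμ3 : μ * x b₃ = x v := by rw [hμ, div_mul_cancel₀ _ xb3.ne']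
    obtain ⟨κ, hκ⟩ : ∃ κ : V → ℝ, κ = fun q => if q ∈ D then μ else 1 := ⟨_, rfl⟩
    have κD : ∀ q ∈ D, κ q = μ := fun q hq => by simp [hκ, hq]
    have κD' : ∀ q, q ∉ D → κ q = 1 := fun q hq => by simp [hκ, hq]
    obtain ⟨sv, sq⟩ := hchain.adjSum_bypass vD h4D hD hμ3 κD κD'
    have hβ : 0 < (x b₄ / x b₃) ^ 2 - ρ * (x b₄ / x b₃) + 1 := by
      have : (x b₄ / x b₃) ^ 2 - ρ * (x b₄ / x b₃) + 1
          = (x b₃ ^ 2 - ρ * x b₃ * x b₄ + x b₄ ^ 2) / x b₃ ^ 2 := by field_simp; ring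
      rw [this]; positivity
    refine hasImprovement_of_rerooted_leg (y := fun q => κ q * x q) (β := x b₄ / x b₃) hiso hvaG
      (fun q r => reachable_of_insertPath_connected hiso hv4G (by rw [hTG]; exact hT.connected))
      ?_ haA hvA ?_ hx ?_ hρ (by simp [κD' v vD]) (by simp [κD' a aD]) hle hav
      ((div_lt_one xb3).2 hlt43) hβ e1 e2 ?_ ?_ ?_
    · rw [← dissociationNumber_insertPath hiso hv4G, hTG]
    · intro q r h hq hr
      rw [hGadj] at h
      rcases h with h | ⟨rfl, rfl⟩ | ⟨rfl, rfl⟩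
      exacts [hA q r h.1 hq hr, absurd hq hvA, absurd hq b4A]
    · intro q
      have := hx q
      by_cases h : q ∈ D
      · rw [κD q h]; positivity
      · rw [κD' q h]; positivity
    · rw [div_mul_cancel₀ _ xb3.ne', e3]
    · rw [sv, heig, hμ]; ring
    · intro q q1 q2 q3 qv
      rw [sq q q1 q2 q3 qv, heig]; ring

/-- Two legs with at least three vertices at a vertex of degree at least three can be
unbalanced. -/
theorem hasImprovement_of_two_legs (hT : T.IsTree) {v a b d : V} {m m' : ℕ}
    (ha : Leg T v a m) (hb : Leg T v b m') (hm : 2 ≤ m) (hm' : 2 ≤ m') (hab : a ≠ b)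
    (hd : T.Adj v d) (hda : d ≠ a) (hdb : d ≠ b) : HasImprovement T := by
  obtain ⟨x, hx, heig⟩ := exists_pos_eigenvector hT.connected
  rcases le_total (x b) (x a) with h | h
  · exact hasImprovement_of_two_legs_of_le hT ha hb hm hm' hab hd hda hdb hx heig h
  · exact hasImprovement_of_two_legs_of_le hT hb ha hm' hm hab.symm hd hdb hda hx heig h

end TwoLegs

/-! ### Recognizing brooms -/

section Broom

variable {V : Type*} {T : SimpleGraph V}

/-- The vertices of a leg at `v`, numbered from `v` on. -/
theorem Leg.exists_vertices {v a : V} {m : ℕ} (h : Leg T v a m) :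
    ∃ c : ℕ → V, c 0 = v ∧ c 1 = a ∧
      (∀ i < m, ∀ r, T.Adj (c (i + 1)) r ↔ r = c i ∨ r = c (i + 2)) ∧
      ∀ r, T.Adj (c (m + 1)) r ↔ r = c m := by
  induction h with
  | @leaf v a h =>
    exact ⟨fun i => if i = 0 then v else a, by simp, by simp, by simp, by simpa using h⟩
  | @cons v a a' m _ h hleg ih =>
    obtain ⟨c, h0, h1, h3, h4⟩ := ih
    refine ⟨fun i => if i = 0 then v else c (i - 1), by simp, by simpa using h0, ?_, ?_⟩
    · intro i hi
      rcases i with _ | i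
      · simpa [h0, h1] using h
      · simpa using h3 i (by omega)
    · simpa using h4

/-- A leg at a vertex with at least three neighbours has no repeated vertices. -/
theorem leg_vertices_injective {c : ℕ → V} {m : ℕ} {d e : V}
    (hc : ∀ i < m, ∀ r, T.Adj (c (i + 1)) r ↔ r = c i ∨ r = c (i + 2))
    (hcm : ∀ r, T.Adj (c (m + 1)) r ↔ r = c m)
    (hd : T.Adj (c 0) d) (he : T.Adj (c 0) e) (hd1 : d ≠ c 1) (he1 : e ≠ c 1) (hde : d ≠ e) :
    ∀ i j, i < j → j ≤ m + 1 → c i ≠ c j := by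
  have h01 : T.Adj (c 0) (c 1) := by
    rcases Nat.eq_zero_or_pos m with rfl | hm
    · exact ((hcm _).2 rfl).symm
    · exact ((hc 0 hm _).2 (Or.inl rfl)).symm
  intro i
  induction i with
  | zero =>
    intro j hj hjm heq
    obtain ⟨k, rfl⟩ : ∃ k, j = k + 1 := ⟨j - 1, by omega⟩
    rw [heq] at hd he h01
    rcases (show k < m ∨ k = m by omega) with hk | rfl
    · rw [hc k hk] at hd he h01
      grind
    · rw [hcm] at hd he
      exact hde (hd.trans he.symm)
  | succ i ih =>
    intro j hj hjm heq
    obtain ⟨k, rfl⟩ : ∃ k, j = k + 1 := ⟨j - 1, by omega⟩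
    have hadj : T.Adj (c (i + 1)) (c i) := (hc i (by omega) _).2 (Or.inl rfl)
    rw [heq] at hadj
    rcases (show k < m ∨ k = m by omega) with hk | rfl
    · rw [hc k hk] at hadj
      rcases hadj with h | h
      · exact ih k (by omega) (by omega) h
      · exact ih (k + 2) (by omega) (by omega) h
    · rw [hcm] at hadj
      exact ih k (by omega) (by omega) hadj

/-- A connected graph in which a vertex `v = c 0` carries one leg `c 1, …, c (m + 1)`, leaves `l i`
and pendant edges `e j — f j` is the graph `broomOnPath`. -/
theorem nonempty_iso_broomOnPath (hT : T.Connected) {c : ℕ → V} {m s t : ℕ} (hm : 2 ≤ m)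
    {l : Fin s → V} {e f : Fin t → V} (hl : Function.Injective l) (he : Function.Injective e)
    (hinj : ∀ i j, i < j → j ≤ m + 1 → c i ≠ c j)
    (hc : ∀ i < m, ∀ r, T.Adj (c (i + 1)) r ↔ r = c i ∨ r = c (i + 2))
    (hcm : ∀ r, T.Adj (c (m + 1)) r ↔ r = c m)
    (hv : ∀ r, T.Adj (c 0) r ↔ r = c 1 ∨ (∃ i, r = l i) ∨ ∃ j, r = e j)
    (hl1 : ∀ i, l i ≠ c 1) (he1 : ∀ j, e j ≠ c 1) (hf : ∀ j, f j ≠ c 0)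
    (hlN : ∀ i r, T.Adj (l i) r ↔ r = c 0) (heN : ∀ j r, T.Adj (e j) r ↔ r = c 0 ∨ r = f j)
    (hfN : ∀ j r, T.Adj (f j) r ↔ r = e j) : Nonempty (T ≃g broomOnPath (m + 2) s t) := by
  set φ : Fin (m + 2) ⊕ Fin s ⊕ Fin t × Fin 2 → V := fun x =>
    match x with
    | .inl i => c i.val
    | .inr (.inl i) => l i
    | .inr (.inr (j, k)) => if k = 0 then e j else f j with hφ
  have hadj : ∀ x r, T.Adj (φ x) r ↔ ∃ y, (broomOnPath (m + 2) s t).Adj x y ∧ φ y = r := by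
    intro x r
    rcases x with ⟨i, hi⟩ | i | ⟨j, k⟩
    · rcases i with _ | i
      · change T.Adj (c 0) r ↔ _
        rw [hv]
        constructor
        · rintro (rfl | ⟨i, rfl⟩ | ⟨j, rfl⟩)
          · exact ⟨.inl ⟨1, by omega⟩, by simp [broomOnPath], rfl⟩
          · exact ⟨.inr (.inl i), by simp [broomOnPath], rfl⟩
          · exact ⟨.inr (.inr (j, 0)), by simp [broomOnPath], rfl⟩
        · rintro ⟨⟨i, hi⟩ | i | ⟨j, k⟩, hy, rfl⟩
          · have : i = 1 := by simp [broomOnPath] at hy; omega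
            subst this; exact Or.inl rfl
          · exact Or.inr (Or.inl ⟨i, rfl⟩)
          · have : k = 0 := by simpa [broomOnPath] using hy
            subst this; exact Or.inr (Or.inr ⟨j, rfl⟩)
      · change T.Adj (c (i + 1)) r ↔ _
        have hback : (broomOnPath (m + 2) s t).Adj (.inl ⟨i + 1, hi⟩) (.inl ⟨i, by omega⟩) := by
          simp [broomOnPath]
        rcases (show i < m ∨ i = m by omega) with him | rfl
        · rw [hc i him]
          constructor
          · rintro (rfl | rfl)
            · exact ⟨_, hback, rfl⟩
            · exact ⟨.inl ⟨i + 2, by omega⟩, by simp [broomOnPath], rfl⟩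
          · rintro ⟨⟨i', hi'⟩ | i' | ⟨j, k⟩, hy, rfl⟩
            · have : i' = i ∨ i' = i + 2 := by simp [broomOnPath] at hy; omega
              rcases this with rfl | rfl
              exacts [Or.inl rfl, Or.inr rfl]
            · simp [broomOnPath] at hy
            · simp [broomOnPath] at hy
        · rw [hcm]
          constructor
          · rintro rfl
            exact ⟨_, hback, rfl⟩
          · rintro ⟨⟨i', hi'⟩ | i' | ⟨j, k⟩, hy, rfl⟩
            · have : i' = i := by simp [broomOnPath] at hy; omega
              subst this; rfl
            · simp [broomOnPath] at hy
            · simp [broomOnPath] at hy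
    · change T.Adj (l i) r ↔ _
      rw [hlN]
      constructor
      · rintro rfl
        exact ⟨.inl ⟨0, by omega⟩, by simp [broomOnPath], rfl⟩
      · rintro ⟨⟨i', hi'⟩ | i' | ⟨j, k⟩, hy, rfl⟩
        · have : i' = 0 := by simpa [broomOnPath] using hy
          subst this; rfl
        · simp [broomOnPath] at hy
        · simp [broomOnPath] at hy
    · obtain rfl | rfl : k = 0 ∨ k = 1 := by fin_cases k <;> simp
      · change T.Adj (e j) r ↔ _
        rw [heN]
        constructor
        · rintro (rfl | rfl)
          · exact ⟨.inl ⟨0, by omega⟩, by simp [broomOnPath], rfl⟩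
          · exact ⟨.inr (.inr (j, 1)), by simp [broomOnPath], rfl⟩
        · rintro ⟨⟨i', hi'⟩ | i' | ⟨j', k⟩, hy, rfl⟩
          · have : i' = 0 := by simpa [broomOnPath] using hy
            subst this; exact Or.inl rfl
          · simp [broomOnPath] at hy
          · have : j' = j ∧ k = 1 := by
              simp [broomOnPath] at hy; grind
            obtain ⟨rfl, rfl⟩ := this
            exact Or.inr rfl
      · change T.Adj (f j) r ↔ _
        rw [hfN]
        constructor
        · rintro rfl
          exact ⟨.inr (.inr (j, 0)), by simp [broomOnPath], rfl⟩
        · rintro ⟨⟨i', hi'⟩ | i' | ⟨j', k⟩, hy, rfl⟩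
          · simp [broomOnPath] at hy
          · simp [broomOnPath] at hy
          · have : j' = j ∧ k = 0 := by
              simp [broomOnPath] at hy; grind
            obtain ⟨rfl, rfl⟩ := this
            rfl
  have hsurj : Function.Surjective φ := by
    have hclosed : ∀ {q r}, T.Walk q r → q ∈ Set.range φ → r ∈ Set.range φ := by
      intro q r p
      induction p with
      | nil => exact id
      | cons h _ ih =>
        rintro ⟨x, rfl⟩
        obtain ⟨y, -, hy⟩ := (hadj x _).1 h
        exact ih ⟨y, hy⟩
    intro r
    obtain ⟨p⟩ := hT.preconnected (c 0) r
    exact hclosed p ⟨.inl ⟨0, by omega⟩, rfl⟩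
  -- The only vertex of the long leg adjacent to `c 0` is `c 1`.
  have hc0 : ∀ i ≤ m + 1, T.Adj (c i) (c 0) → i = 1 := by
    intro i hi h
    rcases i with _ | i
    · exact absurd h (T.irrefl)
    rcases (show i < m ∨ i = m by omega) with him | rfl
    · rw [hc i him] at h
      rcases h with h | h
      · by_contra hne
        exact hinj 0 i (by omega) (by omega) h
      · exact absurd h (hinj 0 (i + 2) (by omega) (by omega))
    · rw [hcm] at h
      exact absurd h (hinj 0 i (by omega) (by omega))
  have hcl : ∀ i ≤ m + 1, ∀ j, c i ≠ l j := by
    intro i hi j h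
    have h1 := hc0 i hi (h ▸ (hlN j _).2 rfl)
    subst h1
    exact hl1 j h.symm
  have hce : ∀ i ≤ m + 1, ∀ j, c i ≠ e j := by
    intro i hi j h
    have h1 := hc0 i hi (h ▸ (heN j _).2 (Or.inl rfl))
    subst h1
    exact he1 j h.symm
  have hcf : ∀ i ≤ m + 1, ∀ j, c i ≠ f j := by
    intro i hi j h
    have hN : ∀ r, T.Adj (c i) r ↔ r = e j := fun r => by rw [h, hfN]
    rcases i with _ | i
    · exact hf j h.symm
    rcases (show i < m ∨ i = m by omega) with him | rfl
    · have h1 := (hN (c i)).1 ((hc i him _).2 (Or.inl rfl))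
      exact hce i (by omega) j h1
    · exact hce i (by omega) j ((hN (c i)).1 ((hcm _).2 rfl))
  have hcc : ∀ i ≤ m + 1, ∀ j ≤ m + 1, c i = c j → i = j := by
    intro i hi j hj h
    rcases lt_trichotomy i j with hlt | heq | hlt
    · exact absurd h (hinj i j hlt hj)
    · exact heq
    · exact absurd h.symm (hinj j i hlt hi)
  have hle : ∀ i j, l i ≠ e j := fun i j h =>
    hf j ((hlN i (f j)).1 (h ▸ (heN j (f j)).2 (Or.inr rfl)))
  have hlf : ∀ i j, l i ≠ f j := fun i j h =>
    hce 0 (by omega) j ((hfN j (c 0)).1 (h ▸ (hlN i (c 0)).2 rfl))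
  have hef : ∀ i j, e i ≠ f j := fun i j h =>
    hce 0 (by omega) j ((hfN j (c 0)).1 (h ▸ (heN i (c 0)).2 (Or.inl rfl)))
  have hff : ∀ i j, f i = f j → i = j := fun i j h =>
    he ((hfN j (e i)).1 (h ▸ (hfN i (e i)).2 rfl))
  have hφinj : Function.Injective φ := by
    have e01 : ∀ k : Fin 2, k ≠ 0 → k = 1 := by decide
    rintro (⟨i, hi⟩ | i | ⟨j, k⟩) (⟨i', hi'⟩ | i' | ⟨j', k'⟩) h <;> simp only [hφ] at h
    · have := hcc i (by omega) i' (by omega) h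
      subst this; rfl
    · exact absurd h (hcl i (by omega) i')
    · split_ifs at h
      exacts [absurd h (hce i (by omega) j'), absurd h (hcf i (by omega) j')]
    · exact absurd h.symm (hcl i' (by omega) i)
    · rw [hl h]
    · split_ifs at h
      exacts [absurd h (hle i j'), absurd h (hlf i j')]
    · split_ifs at h
      exacts [absurd h.symm (hce i' (by omega) j), absurd h.symm (hcf i' (by omega) j)]
    · split_ifs at h
      exacts [absurd h.symm (hle i' j), absurd h.symm (hlf i' j)]
    · split_ifs at h with h1 h2 h2
      · rw [he h, h1, h2]
      · exact absurd h (hef j j')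
      · exact absurd h.symm (hef j' j)
      · rw [hff j j' h, e01 k h1, e01 k' h2]
  refine ⟨RelIso.symm ⟨Equiv.ofBijective φ ⟨hφinj, hsurj⟩, ?_⟩⟩
  intro x y
  change T.Adj (φ x) (φ y) ↔ _
  rw [hadj]
  exact ⟨fun ⟨y', h, h'⟩ => hφinj h' ▸ h, fun h => ⟨y, h, rfl⟩⟩

/-- A connected graph consisting of a vertex `v` of degree at least three, one leg with at least
three vertices at `v`, and otherwise leaves and pendant edges at `v`, is a graph `broomOnPath`. -/
theorem exists_iso_broomOnPath [Fintype V] (hT : T.Connected) {v a d e : V} {m : ℕ}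
    (ha : Leg T v a m) (hm : 2 ≤ m) (hd : T.Adj v d) (he : T.Adj v e) (hda : d ≠ a)
    (hea : e ≠ a) (hde : d ≠ e)
    (hleg : ∀ r, T.Adj v r → r ≠ a → Leg T v r 0 ∨ Leg T v r 1)
    (hone : ∃ r, r ≠ a ∧ Leg T v r 1) :
    ∃ s t : ℕ, 0 < t ∧ Nonempty (T ≃g broomOnPath (m + 2) s t) := by
  classical
  obtain ⟨c, rfl, rfl, hc, hcm⟩ := ha.exists_vertices
  have hinj := leg_vertices_injective hc hcm hd he hda hea hde
  obtain ⟨r₀, hr₀, hleg₀⟩ := hone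
  let L := {r : V // r ≠ c 1 ∧ Leg T (c 0) r 0}
  let E := {r : V // r ≠ c 1 ∧ Leg T (c 0) r 1}
  have hE : ∀ r : E, ∃ f, f ≠ c 0 ∧ (∀ q, T.Adj r.1 q ↔ q = c 0 ∨ q = f) ∧
      ∀ q, T.Adj f q ↔ q = r.1 := by
    rintro ⟨r, hr, h⟩
    rcases h with _ | @⟨_, _, f, _, hne, h1, hl⟩
    rcases hl with h2 | _
    exact ⟨f, hne, h1, h2⟩
  choose f hf hf1 hf2 using hE
  let eL := Fintype.equivFin L
  let eE := Fintype.equivFin E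
  have : Nonempty E := ⟨⟨r₀, hr₀, hleg₀⟩⟩
  refine ⟨Fintype.card L, Fintype.card E, Fintype.card_pos, ?_⟩
  refine nonempty_iso_broomOnPath hT hm (c := c) (l := fun i => (eL.symm i).1)
    (e := fun j => (eE.symm j).1) (f := fun j => f (eE.symm j))
    (Subtype.val_injective.comp eL.symm.injective) (Subtype.val_injective.comp eE.symm.injective)
    hinj hc hcm ?_ (fun i => (eL.symm i).2.1) (fun j => (eE.symm j).2.1)
    (fun j => hf _) ?_ (fun j => hf1 _) (fun j => hf2 _)
  · intro r
    constructor
    · intro h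
      by_cases hr : r = c 1
      · exact Or.inl hr
      rcases hleg r h hr with h' | h'
      · exact Or.inr (Or.inl ⟨eL ⟨r, hr, h'⟩, by simp⟩)
      · exact Or.inr (Or.inr ⟨eE ⟨r, hr, h'⟩, by simp⟩)
    · rintro (rfl | ⟨i, rfl⟩ | ⟨j, rfl⟩)
      exacts [ha.adj, (eL.symm i).2.2.adj, (eE.symm j).2.2.adj]
  · intro i
    rcases (eL.symm i).2.2 with h | _
    exact h

end Broom

/-! ### Minimizing trees -/

theorem mainTheorem3 (n k : ℕ) (hk : ⌈(2 * (n : ℚ)) / 3⌉₊ < k) (hkn : k ≤ n - 1)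
    (T : SimpleGraph (Fin n)) (hT : T.IsTree) (hmin : AttainsMinSpectralRadius n k T) :
    (∀ (v a b : Fin n) (p : T.Walk a b), IsBranchPath T v p → p.length ≤ 1) ∨
      ∃ s t : ℕ, 0 < t ∧ s + 2 * t < n ∧ Nonempty (T ≃g broomTree n s t) := by
  have hbest : ¬ HasImprovement T := by
    rintro ⟨H, hconn, hdiss, hlt⟩
    exact absurd (hmin.2 H ⟨hconn, hdiss.trans hmin.1.2⟩) (not_le.2 hlt)
  refine or_iff_not_imp_left.2 fun hlong => ?_
  push Not at hlong
  obtain ⟨v, a, b, p, hp, hlen⟩ := hlong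
  have ha := hp.leg
  have hm : 2 ≤ p.length := hlen
  generalize p.length = m at ha hm
  obtain ⟨z, c₁, c₂, c₃, hpend⟩ := ha.exists_pendantTriple hm
  have hunique : ∀ w, w ≠ v → (T.neighborSet w).encard ≤ 2 := by
    intro w hw
    by_contra hlt
    obtain ⟨P, hP⟩ := exists_isBranchCore hT.connected hw (not_le.1 hlt) hp.branch
    exact hbest (hasImprovement_of_isBranchCore hT hP hpend)
  obtain ⟨d, hd, hda, e, he, hea, hed⟩ := exists_three_of_two_lt_encard hp.branch a ha.adj
  have hleg : ∀ r, T.Adj v r → r ≠ a → Leg T v r 0 ∨ Leg T v r 1 := by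
    intro r hr hra
    obtain ⟨j, hj⟩ := exists_leg_of_isAcyclic hT.isAcyclic hunique hr
    rcases (show j = 0 ∨ j = 1 ∨ 2 ≤ j by omega) with rfl | rfl | h2
    · exact Or.inl hj
    · exact Or.inr hj
    · -- A third neighbour of `v` besides `a` and `r`.
      obtain ⟨q, hq, hqa, hqr⟩ : ∃ q, T.Adj v q ∧ q ≠ a ∧ q ≠ r := by
        by_cases h : d = r
        · exact ⟨e, he, hea, h ▸ hed⟩
        · exact ⟨d, hd, hda, h⟩
      exact absurd (hasImprovement_of_two_legs hT ha hj hm h2 hra.symm hq hqa hqr) hbest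
  have hone : ∃ r, r ≠ a ∧ Leg T v r 1 := by
    rcases hleg d hd hda with h1 | h1
    · rcases hleg e he hea with h2 | h2
      · cases h1 with
        | leaf h1 =>
          cases h2 with
          | leaf h2 =>
            exact absurd (hasImprovement_of_two_leaves hT.connected hed.symm h1 h2 ha.adj
              hda.symm hea.symm) hbest
      · exact ⟨e, hea, h2⟩
    · exact ⟨d, hda, h1⟩
  obtain ⟨s, t, ht, ⟨φ⟩⟩ :=
    exists_iso_broomOnPath hT.connected ha hm hd he hda hea hed.symm hleg hone
  have hcard : n = (m + 2) + (s + t * 2) := by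
    have := Fintype.card_congr φ.toEquiv
    simpa using this
  refine ⟨s, t, ht, by omega, ?_⟩
  have hpath : n - s - 2 * t = m + 2 := by omega
  rw [broomTree, hpath]
  exact ⟨φ⟩
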